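/- Let $(A,\Delta)$ be an algebraic quantum group over $\mathbb C$: a regular multiplier Hopf algebra with a fixed non-zero left integral $\varphi$. (So $A$ is an algebra with non-degenerate product, not necessarily unital; $\Delta:A\to M(A\otimes A)$ is a coassociative homomorphism into the multiplier algebra; the maps sending $a\otimes b$ to $\Delta(a)(1\otimes b)$, $(a\otimes 1)\Delta(b)$, $\Delta(a)(b\otimes 1)$ and $(1\otimes a)\Delta(b)$ are bijections of $A\otimes A$ onto itself; and $(\iota\otimes\varphi)\Delta(a)=\varphi(a)1$ for all $a$.) Let $B=\widehat A=\{\varphi(\,\cdot\,c): c\in A\}$ be its dual, with pairing $\langle a,b\rangle=b(a)$, product $\langle a,bb'\rangle=\langle\Delta(a),b\otimes b'\rangle$, coproduct $\langle a\otimes a',\Delta(b)\rangle=\langle aa',b\rangle$, and let $B$ act on $A$ from the left by $b\triangleright x=(\iota\otimes\langle\,\cdot\,,b\rangle)\Delta(x)$. Let $AB$ be the Heisenberg algebra: the space $A\otimes B$ with the product $$(a\otimes b)(a'\otimes b')=\sum \langle a'_{(2)},b_{(1)}\rangle\, aa'_{(1)}\otimes b_{(2)}b'.$$ There is a unique $V\in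 M(B\otimes A)$ with $\langle V,a\otimes b\rangle=\langle a,b\rangle$ for all $a\in A$, $b\in B$, where the pairing of $B\otimes A$ with $A\otimes B$, given by $\langle b\otimes a,a'\otimes b'\rangle=\langle a',b\rangle\langle a,b'\rangle$, is extended to $M(B\otimes A)\times(A\otimes B)$ by $\langle m,c\triangleright d\rangle=\langle mc,d\rangle$ for $c\in B\otimes A$, $d\in A\otimes B$; here $(b\otimes a)\triangleright(a'\otimes b')=(b\triangleright a')\otimes(a\triangleright b')$ and $\langle a'',a\triangleright b'\rangle=\langle a''a,b'\rangle$. The action $(b\otimes a)\triangleright(x\otimes x')=(b\triangleright x)\otimes ax'$ of $B\otimes A$ on $A\otimes A$ extends uniquely to a unital action of $M(B\otimes A)$, and under this action $V$ acts as the canonical map: $$V\triangleright(x\otimes x')=T(x\otimes x')=\Delta(x)(1\otimes x')\qquad (x,x'\in A).$$ Moreover the homomorphisms $b\otimes a\mapsto b\otimes j_A(a)\otimes 1$, $b\otimes a\mapsto b\otimes 1\otimes a$ and $b\otimes a\mapsto 1\otimes j_B(b)\otimes a$ from $B\otimes A$ to $M(B\otimes AB\otimes A)$ extend uniquely to unital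 homomorphisms on $M(B\otimes A)$, where $j_A:A\to M(AB)$ and $j_B:B\to M(AB)$ are the embeddings with $j_A(a)j_B(b)=a\otimes b$; that is, $j_A(a)(a'\otimes b')=aa'\otimes b'$ and $j_B(b)(a'\otimes b')=\sum\langle a'_{(2)},b_{(1)}\rangle\,a'_{(1)}\otimes b_{(2)}b'$. Writing $V_{12}$, $V_{13}$, $V_{23}$ for the images of $V$, the pentagon equation holds in $M(B\otimes AB\otimes A)$: $$V_{12}V_{13}V_{23}=V_{23}V_{12}.$$ -/

import Mathlib

open scoped TensorProduct

noncomputable section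

/-! ## Multiplier algebras -/

section Multipliers

variable (A : Type*) [NonUnitalRing A] [Module ℂ A] [IsScalarTower ℂ A A] [SMulCommClass ℂ A A]

/-- The pairs `(L, R)` making up the multiplier algebra of `A`: pairs `m = (L, R)` of linear maps on `A` with
`a (L b) = (R a) b`; one thinks of `L b` as `m b` and of `R a` as `a m`. The product is
`(L, R) (L', R') = (L ∘ L', R' ∘ R)` and the unit is `(id, id)`. -/
def multiplierSubalgebra : Subalgebra ℂ (Module.End ℂ A × (Module.End ℂ A)ᵐᵒᵖ) where
  carrier := {m | ∀ a b : A, a * m.1 b = m.2.unop a * b}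
  mul_mem' := by
    intro m n hm hn a b
    simp only [Set.mem_ofPred_eq] at hm hn
    simp [hm, hn]
  add_mem' := by
    intro m n hm hn a b
    simp only [Set.mem_ofPred_eq] at hm hn
    simp [hm, hn, mul_add, add_mul]
  algebraMap_mem' := by
    intro r a b
    simp [Algebra.algebraMap_eq_smul_one, mul_smul_comm, smul_mul_assoc]

/-- The multiplier algebra `M(A)`. -/
def Multiplier : Type _ := ↥(multiplierSubalgebra A)

instance : Ring (Multiplier A) := inferInstanceAs (Ring ↥(multiplierSubalgebra A))

instance : Algebra ℂ (Multiplier A) := inferInstanceAs (Algebra ℂ ↥(multiplierSubalgebra A))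

/-- The product of `A` is non-degenerate. -/
def IsNondegenerateProduct : Prop :=
  (∀ a : A, (∀ b, a * b = 0) → a = 0) ∧ (∀ a : A, (∀ b, b * a = 0) → a = 0)

variable {A}

namespace Multiplier

/-- `m.lmul b` is `m b`. -/
def lmul (m : Multiplier A) : A →ₗ[ℂ] A := m.1.1

/-- `m.rmul a` is `a m`. -/
def rmul (m : Multiplier A) : A →ₗ[ℂ] A := m.1.2.unop

lemma compat (m : Multiplier A) (a b : A) : a * m.lmul b = m.rmul a * b := m.2 a b

lemma ext' {m n : Multiplier A} (h : m.lmul = n.lmul) (h' : m.rmul = n.rmul) : m = n :=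
  Subtype.ext (Prod.ext h (MulOpposite.unop_injective h'))

/-- The multiplier with given left and right multiplications. -/
def mk' (L R : A →ₗ[ℂ] A) (h : ∀ a b, a * L b = R a * b) : Multiplier A :=
  ⟨(L, MulOpposite.op R), h⟩

/-- The embedding of `A` in `M(A)`. -/
def of (a : A) : Multiplier A :=
  mk' (LinearMap.mulLeft ℂ a) (LinearMap.mulRight ℂ a) (fun b c => by simp [mul_assoc])

@[simp] lemma lmul_mk' (L R : A →ₗ[ℂ] A) (h) : (mk' L R h).lmul = L := rfl
@[simp] lemma rmul_mk' (L R : A →ₗ[ℂ] A) (h) : (mk' L R h).rmul = R := rfl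
@[simp] lemma lmul_of (a b : A) : (of a).lmul b = a * b := rfl
@[simp] lemma rmul_of (a b : A) : (of a).rmul b = b * a := rfl
@[simp] lemma lmul_mul (m n : Multiplier A) (a : A) : (m * n).lmul a = m.lmul (n.lmul a) := rfl
@[simp] lemma rmul_mul (m n : Multiplier A) (a : A) : (m * n).rmul a = n.rmul (m.rmul a) := rfl
@[simp] lemma lmul_one (a : A) : (1 : Multiplier A).lmul a = a := rfl
@[simp] lemma rmul_one (a : A) : (1 : Multiplier A).rmul a = a := rfl

@[simp] lemma lmul_add (m n : Multiplier A) (a : A) : (m + n).lmul a = m.lmul a + n.lmul a := rfl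
@[simp] lemma rmul_add (m n : Multiplier A) (a : A) : (m + n).rmul a = m.rmul a + n.rmul a := rfl
@[simp] lemma lmul_smul (r : ℂ) (m : Multiplier A) (a : A) : (r • m).lmul a = r • m.lmul a := rfl
@[simp] lemma rmul_smul (r : ℂ) (m : Multiplier A) (a : A) : (r • m).rmul a = r • m.rmul a := rfl

variable {C : Type*} [NonUnitalRing C] [Module ℂ C] [IsScalarTower ℂ C C] [SMulCommClass ℂ C C]

/-- For `m ∈ M(A)` and `n ∈ M(C)` the multiplier `m ⊗ n ∈ M(A ⊗ C)`. -/
def tmul (m : Multiplier A) (n : Multiplier C) : Multiplier (A ⊗[ℂ] C) :=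
  mk' (TensorProduct.map m.lmul n.lmul) (TensorProduct.map m.rmul n.rmul) (by
    intro x y
    induction x with
    | zero => simp
    | add x x' hx hx' => simp [add_mul, hx, hx']
    | tmul a c =>
      induction y with
      | zero => simp
      | add y y' hy hy' => simp only [mul_add, map_add, hy, hy']
      | tmul a' c' => simp [compat])

@[simp] lemma lmul_tmul (m : Multiplier A) (n : Multiplier C) (x : A ⊗[ℂ] C) :
    (tmul m n).lmul x = TensorProduct.map m.lmul n.lmul x := rfl

end Multiplier

end Multipliers

/-! ## Algebraic quantum groups -/

/-- A regular multiplier Hopf algebra over `ℂ`, with a fixed left integral `φ`.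
The maps `T₁, T₂, T₃, T₄` are determined by the coproduct (`A ⊗ A` embeds in `M(A ⊗ A)`); giving
them as linear equivalences of `A ⊗ A` expresses that `Δ(a)(1 ⊗ b)`, `(a ⊗ 1)Δ(b)`,
`Δ(a)(b ⊗ 1)` and `(1 ⊗ a)Δ(b)` lie in `A ⊗ A` and that the four induced maps of `A ⊗ A` are
bijective: `T₁` and `T₂` for a multiplier Hopf algebra, `T₃` and `T₄` for regularity. -/
structure AlgebraicQuantumGroup (A : Type*) [NonUnitalRing A] [Module ℂ A] [IsScalarTower ℂ A A]
    [SMulCommClass ℂ A A] where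
  nondegenerate : IsNondegenerateProduct A
  /-- the coproduct, an algebra homomorphism `A → M(A ⊗ A)` -/
  Δ : A →ₙₐ[ℂ] Multiplier (A ⊗[ℂ] A)
  /-- the canonical map `a ⊗ b ↦ Δ(a)(1 ⊗ b)` -/
  T₁ : (A ⊗[ℂ] A) ≃ₗ[ℂ] (A ⊗[ℂ] A)
  T₁_spec : ∀ a b, Δ a * Multiplier.tmul 1 (.of b) = .of (T₁ (a ⊗ₜ b))
  /-- `a ⊗ b ↦ (a ⊗ 1)Δ(b)` -/
  T₂ : (A ⊗[ℂ] A) ≃ₗ[ℂ] (A ⊗[ℂ] A)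
  T₂_spec : ∀ a b, Multiplier.tmul (.of a) 1 * Δ b = .of (T₂ (a ⊗ₜ b))
  /-- `a ⊗ b ↦ Δ(a)(b ⊗ 1)` -/
  T₃ : (A ⊗[ℂ] A) ≃ₗ[ℂ] (A ⊗[ℂ] A)
  T₃_spec : ∀ a b, Δ a * Multiplier.tmul (.of b) 1 = .of (T₃ (a ⊗ₜ b))
  /-- `a ⊗ b ↦ (1 ⊗ a)Δ(b)` -/
  T₄ : (A ⊗[ℂ] A) ≃ₗ[ℂ] (A ⊗[ℂ] A)
  T₄_spec : ∀ a b, Multiplier.tmul 1 (.of a) * Δ b = .of (T₄ (a ⊗ₜ b))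
  /-- coassociativity:
  `(a ⊗ 1 ⊗ 1) (Δ ⊗ ι)(Δ(b)(1 ⊗ c)) = (ι ⊗ Δ)((a ⊗ 1)Δ(b)) (1 ⊗ 1 ⊗ c)` in `A ⊗ A ⊗ A` -/
  coassoc : ∀ a b c : A,
    TensorProduct.assoc ℂ A A A
        (T₂.toLinearMap.rTensor A ((TensorProduct.assoc ℂ A A A).symm (a ⊗ₜ T₁ (b ⊗ₜ c)))) =
      T₁.toLinearMap.lTensor A (TensorProduct.assoc ℂ A A A (T₂ (a ⊗ₜ b) ⊗ₜ c))
  /-- the left integral -/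
  φ : A →ₗ[ℂ] ℂ
  φ_ne_zero : φ ≠ 0
  /-- left invariance `(ι ⊗ φ)Δ(a) = φ(a) 1`, that is
  `(ι ⊗ φ)(Δ(a)(b ⊗ 1)) = φ(a) b` for all `b` -/
  left_invariant : ∀ a b, TensorProduct.rid ℂ A (φ.lTensor A (T₃ (a ⊗ₜ b))) = φ a • b

/-! ### Facts from linear algebra -/

section LinearAlgebra

variable {X Y Z : Type*} [AddCommGroup X] [Module ℂ X] [AddCommGroup Y] [Module ℂ Y]
  [AddCommGroup Z] [Module ℂ Z]

/-- Jointly injective linear maps remain jointly injective after tensoring. -/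
lemma rTensor_jointly_injective {ι : Type*} (f : ι → X →ₗ[ℂ] Z)
    (hf : ∀ x, (∀ i, f i x = 0) → x = 0) (t : X ⊗[ℂ] Y)
    (ht : ∀ i, (f i).rTensor Y t = 0) : t = 0 := by
  classical
  let b := Module.Basis.ofVectorSpace ℂ Y
  apply (TensorProduct.equivFinsuppOfBasisRight b).injective
  rw [map_zero]
  ext k
  apply hf
  intro i
  have key : ∀ s : X ⊗[ℂ] Y, f i (TensorProduct.equivFinsuppOfBasisRight b s k)
      = TensorProduct.equivFinsuppOfBasisRight b ((f i).rTensor Y s) k := by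
    intro s
    induction s with
    | zero => simp
    | add x y hx hy => simp [hx, hy]
    | tmul x y => simp
  rw [key, ht]; simp

lemma lTensor_jointly_injective {ι : Type*} (f : ι → X →ₗ[ℂ] Z)
    (hf : ∀ x, (∀ i, f i x = 0) → x = 0) (t : Y ⊗[ℂ] X)
    (ht : ∀ i, (f i).lTensor Y t = 0) : t = 0 := by
  apply (TensorProduct.comm ℂ Y X).injective
  rw [map_zero]
  apply rTensor_jointly_injective f hf
  intro i
  have key : ∀ s : Y ⊗[ℂ] X, (f i).rTensor Y (TensorProduct.comm ℂ Y X s)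
      = TensorProduct.comm ℂ Y Z ((f i).lTensor Y s) := by
    intro s
    induction s with
    | zero => simp
    | add x y hx hy => simp [hx, hy]
    | tmul x y => simp
  rw [key, ht]; simp

end LinearAlgebra

section Nondegenerate

variable {A : Type*} [NonUnitalRing A] [Module ℂ A] [IsScalarTower ℂ A A] [SMulCommClass ℂ A A]
variable {C : Type*} [NonUnitalRing C] [Module ℂ C] [IsScalarTower ℂ C C] [SMulCommClass ℂ C C]

lemma tensor_mul_eq (a : A) (c : C) (t : A ⊗[ℂ] C) :
    t * (a ⊗ₜ c) = (LinearMap.mulRight ℂ c).lTensor A ((LinearMap.mulRight ℂ a).rTensor C t) := by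
  induction t with
  | zero => simp
  | add x y hx hy => simp only [add_mul, map_add, hx, hy]
  | tmul x y => simp

lemma mul_tensor_eq (a : A) (c : C) (t : A ⊗[ℂ] C) :
    (a ⊗ₜ c) * t = (LinearMap.mulLeft ℂ c).lTensor A ((LinearMap.mulLeft ℂ a).rTensor C t) := by
  induction t with
  | zero => simp
  | add x y hx hy => simp only [mul_add, map_add, hx, hy]
  | tmul x y => simp

lemma IsNondegenerateProduct.tensor (hA : IsNondegenerateProduct A)
    (hC : IsNondegenerateProduct C) : IsNondegenerateProduct (A ⊗[ℂ] C) := by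
  constructor
  · intro t ht
    apply rTensor_jointly_injective (fun a : A => LinearMap.mulRight ℂ a)
      (fun x hx => hA.1 x hx)
    intro a
    apply lTensor_jointly_injective (fun c : C => LinearMap.mulRight ℂ c)
      (fun x hx => hC.1 x hx)
    intro c
    rw [← tensor_mul_eq, ht]
  · intro t ht
    apply rTensor_jointly_injective (fun a : A => LinearMap.mulLeft ℂ a)
      (fun x hx => hA.2 x hx)
    intro a
    apply lTensor_jointly_injective (fun c : C => LinearMap.mulLeft ℂ c)
      (fun x hx => hC.2 x hx)
    intro c
    rw [← mul_tensor_eq, ht]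

namespace Multiplier

lemma lmul_mul_right (hA : IsNondegenerateProduct A) (m : Multiplier A) (a b : A) :
    m.lmul (a * b) = m.lmul a * b := by
  rw [← sub_eq_zero]
  apply hA.2
  intro c
  rw [mul_sub, compat, ← mul_assoc, ← mul_assoc, compat, sub_self]

lemma of_injective (hA : IsNondegenerateProduct A) : Function.Injective (of : A → Multiplier A) := by
  intro a b h
  rw [← sub_eq_zero]
  apply hA.1
  intro c
  have := congrArg (fun m => m.lmul c) h
  simp only [lmul_of] at this
  rw [sub_mul, this, sub_self]

lemma mul_of (hA : IsNondegenerateProduct A) (m : Multiplier A) (a : A) :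
    m * of a = of (m.lmul a) := by
  apply ext'
  · ext b; simp [lmul_mul_right hA]
  · ext b; simp [compat]

end Multiplier

end Nondegenerate

namespace AlgebraicQuantumGroup

variable {A : Type*} [NonUnitalRing A] [Module ℂ A] [IsScalarTower ℂ A A] [SMulCommClass ℂ A A]
variable (G : AlgebraicQuantumGroup A)

open Multiplier

/-- The slice map `ι ⊗ φ : A ⊗ A → A`. -/
def slice : A ⊗[ℂ] A →ₗ[ℂ] A := (TensorProduct.rid ℂ A).toLinearMap ∘ₗ G.φ.lTensor A

@[simp] lemma slice_tmul (a b : A) : G.slice (a ⊗ₜ b) = G.φ b • a := by simp [slice]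

lemma nondegenerate₂ (G : AlgebraicQuantumGroup A) : IsNondegenerateProduct (A ⊗[ℂ] A) := G.nondegenerate.tensor G.nondegenerate

lemma slice_T₃ (a b : A) : G.slice (G.T₃ (a ⊗ₜ b)) = G.φ a • b := G.left_invariant a b

lemma T₁_mulRight (a c d : A) :
    (LinearMap.mulRight ℂ c).rTensor A (G.T₁ (a ⊗ₜ d)) = (G.Δ a).lmul (c ⊗ₜ d) := by
  apply of_injective G.nondegenerate₂
  rw [← mul_of G.nondegenerate₂]
  have h : (of (c ⊗ₜ[ℂ] d) : Multiplier (A ⊗[ℂ] A)) = tmul 1 (of d) * tmul (of c) 1 := by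
    apply ext'
    · ext x y; simp
    · ext x y; simp [tmul]
  rw [h, ← mul_assoc, G.T₁_spec]
  apply ext'
  · ext x y
    simp only [TensorProduct.AlgebraTensorModule.curry_apply, LinearMap.restrictScalars_self,
      TensorProduct.curry_apply, lmul_of, lmul_mul, lmul_tmul]
    generalize G.T₁ (a ⊗ₜ d) = t
    induction t with
    | zero => simp
    | add x y hx hy => simp only [map_add, add_mul, hx, hy]
    | tmul u v => simp [mul_assoc]
  · ext x y
    simp only [TensorProduct.AlgebraTensorModule.curry_apply, LinearMap.restrictScalars_self,
      TensorProduct.curry_apply, rmul_of, rmul_mul, tmul, rmul_mk']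
    generalize G.T₁ (a ⊗ₜ d) = t
    induction t with
    | zero => simp
    | add x y hx hy => simp only [map_add, mul_add, hx, hy]
    | tmul u v => simp [mul_assoc]

lemma T₁_mul (a b c : A) : G.T₁ ((a * b) ⊗ₜ c) = (G.Δ a).lmul (G.T₁ (b ⊗ₜ c)) := by
  apply of_injective G.nondegenerate₂
  rw [← mul_of G.nondegenerate₂, ← G.T₁_spec, ← G.T₁_spec, map_mul, mul_assoc]

lemma T₃_mul (a b c : A) : G.T₃ ((a * b) ⊗ₜ c) = (G.Δ a).lmul (G.T₃ (b ⊗ₜ c)) := by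
  apply of_injective G.nondegenerate₂
  rw [← mul_of G.nondegenerate₂, ← G.T₃_spec, ← G.T₃_spec, map_mul, mul_assoc]

lemma T₂_mul (a b : A) (t : A ⊗[ℂ] A) :
    G.T₂ (a ⊗ₜ b) * t = (LinearMap.mulLeft ℂ a).rTensor A ((G.Δ b).lmul t) := by
  have := congrArg (fun m => m.lmul t) (G.T₂_spec a b)
  simp only [lmul_mul, lmul_of, lmul_tmul] at this
  rw [← this]
  rfl

lemma T₂_T₁ (a b c : A) :
    (LinearMap.mulRight ℂ c).lTensor A (G.T₂ (a ⊗ₜ b)) =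
      (LinearMap.mulLeft ℂ a).rTensor A (G.T₁ (b ⊗ₜ c)) := by
  rw [← sub_eq_zero]
  apply G.nondegenerate₂.1
  intro t
  rw [sub_mul, sub_eq_zero]
  have h1 : ∀ s : A ⊗[ℂ] A, (LinearMap.mulRight ℂ c).lTensor A s * t
      = s * (LinearMap.mulLeft ℂ c).lTensor A t := by
    intro s
    induction s with
    | zero => simp
    | add x y hx hy => simp only [map_add, add_mul, hx, hy]
    | tmul u v =>
      induction t with
      | zero => simp
      | add x y hx hy => simp only [map_add, mul_add, hx, hy]
      | tmul u v => simp [mul_assoc]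
  have h2 : ∀ s : A ⊗[ℂ] A, (LinearMap.mulLeft ℂ a).rTensor A s * t
      = (LinearMap.mulLeft ℂ a).rTensor A (s * t) := by
    intro s
    clear h1
    induction s with
    | zero => simp
    | add x y hx hy => simp only [map_add, add_mul, hx, hy]
    | tmul u v =>
      induction t with
      | zero => simp
      | add x y hx hy => simp only [map_add, mul_add, hx, hy]
      | tmul u v => simp [mul_assoc]
  rw [h1, h2, T₂_mul]
  have := congrArg (fun m => m.lmul t) (G.T₁_spec b c)
  simp only [lmul_mul, lmul_of, lmul_tmul] at this
  rw [← this]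
  rfl

lemma T₃_mulRight (a c d : A) :
    (LinearMap.mulRight ℂ d).lTensor A (G.T₃ (a ⊗ₜ c)) = (G.Δ a).lmul (c ⊗ₜ d) := by
  apply of_injective G.nondegenerate₂
  rw [← mul_of G.nondegenerate₂]
  have h : (of (c ⊗ₜ[ℂ] d) : Multiplier (A ⊗[ℂ] A)) = tmul (of c) 1 * tmul 1 (of d) := by
    apply ext'
    · ext x y; simp
    · ext x y; simp [tmul]
  rw [h, ← mul_assoc, G.T₃_spec]
  apply ext'
  · ext x y
    simp only [TensorProduct.AlgebraTensorModule.curry_apply, LinearMap.restrictScalars_self,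
      TensorProduct.curry_apply, lmul_of, lmul_mul, lmul_tmul]
    generalize G.T₃ (a ⊗ₜ c) = t
    induction t with
    | zero => simp
    | add x y hx hy => simp only [map_add, add_mul, hx, hy]
    | tmul u v => simp [mul_assoc]
  · ext x y
    simp only [TensorProduct.AlgebraTensorModule.curry_apply, LinearMap.restrictScalars_self,
      TensorProduct.curry_apply, rmul_of, rmul_mul, tmul, rmul_mk']
    generalize G.T₃ (a ⊗ₜ c) = t
    induction t with
    | zero => simp
    | add x y hx hy => simp only [map_add, mul_add, hx, hy]
    | tmul u v => simp [mul_assoc]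

lemma slice_mul (t : A ⊗[ℂ] A) (c : A) :
    G.slice t * c = G.slice ((LinearMap.mulRight ℂ c).rTensor A t) := by
  induction t with
  | zero => simp
  | add x y hx hy => simp only [map_add, add_mul, hx, hy]
  | tmul u v => simp [smul_mul_assoc]

lemma mul_slice (t : A ⊗[ℂ] A) (c : A) :
    c * G.slice t = G.slice ((LinearMap.mulLeft ℂ c).rTensor A t) := by
  induction t with
  | zero => simp
  | add x y hx hy => simp only [map_add, mul_add, hx, hy]
  | tmul u v => simp [mul_smul_comm]

/-! ### The dual and its action on `A` -/

/-- The map sending `c` to the functional `φ( · c)`. -/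
def dualMap : A →ₗ[ℂ] Module.Dual ℂ A := (LinearMap.mul ℂ A).flip.compr₂ G.φ

@[simp] lemma dualMap_apply (c a : A) : G.dualMap c a = G.φ (a * c) := rfl

/-- The dual `B` of `A`: the space of functionals `φ( · c)` with `c ∈ A`. -/
def Dual : Type _ := ↥(LinearMap.range G.dualMap)

instance : AddCommGroup G.Dual := inferInstanceAs (AddCommGroup ↥(LinearMap.range G.dualMap))

instance : Module ℂ G.Dual := inferInstanceAs (Module ℂ ↥(LinearMap.range G.dualMap))

/-- An element of `B` as a functional on `A`: `eval b a = ⟨a, b⟩`. -/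
def eval : G.Dual →ₗ[ℂ] Module.Dual ℂ A := (LinearMap.range G.dualMap).subtype

/-- The element `φ( · c)` of `B`. -/
def toDual : A →ₗ[ℂ] G.Dual := G.dualMap.rangeRestrict

@[simp] lemma eval_toDual (c a : A) : G.eval (G.toDual c) a = G.φ (a * c) := rfl

lemma eval_injective : Function.Injective G.eval := Subtype.val_injective

lemma toDual_surjective : Function.Surjective G.toDual := LinearMap.surjective_rangeRestrict _

/-- `c` and `x` are sent to `(ι ⊗ φ)(Δ(x)(1 ⊗ c))`. -/
def sliceAct : A →ₗ[ℂ] Module.End ℂ A :=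
  (TensorProduct.mk ℂ A A).flip.compr₂ (G.slice ∘ₗ G.T₁.toLinearMap)

lemma sliceAct_apply (c x : A) : G.sliceAct c x = G.slice (G.T₁ (x ⊗ₜ c)) := rfl

lemma sliceAct_mul (c x y : A) :
    G.sliceAct c x * y = TensorProduct.rid ℂ A ((G.dualMap c).lTensor A (G.T₃ (x ⊗ₜ y))) := by
  rw [sliceAct_apply, slice_mul, T₁_mulRight, ← T₃_mulRight]
  generalize G.T₃ (x ⊗ₜ y) = t
  induction t with
  | zero => simp
  | add x y hx hy => simp only [map_add, hx, hy]
  | tmul u v => simp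

lemma ker_le_sliceAct : LinearMap.ker G.dualMap ≤ LinearMap.ker G.sliceAct := by
  intro c hc
  rw [LinearMap.mem_ker] at hc ⊢
  ext x
  apply G.nondegenerate.1
  intro y
  rw [sliceAct_mul, hc]
  simp

/-- The left action of `B` on `A`: `b ▷ x = (ι ⊗ ⟨ · , b⟩)Δ(x)`, which for `b = φ( · c)` is
`(ι ⊗ φ)(Δ(x)(1 ⊗ c))`. -/
def act : G.Dual →ₗ[ℂ] Module.End ℂ A :=
  (LinearMap.ker G.dualMap).liftQ G.sliceAct G.ker_le_sliceAct ∘ₗ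
    G.dualMap.quotKerEquivRange.symm.toLinearMap

lemma act_toDual (c x : A) : G.act (G.toDual c) x = G.slice (G.T₁ (x ⊗ₜ c)) := by
  have : G.dualMap.quotKerEquivRange.symm (G.toDual c) = Submodule.Quotient.mk c := by
    exact (LinearEquiv.symm_apply_eq _).2 rfl
  change (LinearMap.ker G.dualMap).liftQ G.sliceAct G.ker_le_sliceAct
    (G.dualMap.quotKerEquivRange.symm (G.toDual c)) x = _
  rw [this]; rfl

lemma act_toDual' (c x : A) : G.act (G.toDual c) x = G.sliceAct c x := G.act_toDual c x

/-- `(b ▷ x) y = (ι ⊗ ⟨ · , b⟩)(Δ(x)(y ⊗ 1))`. -/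
lemma act_mul_right (b : G.Dual) (x y : A) :
    G.act b x * y = TensorProduct.rid ℂ A ((G.eval b).lTensor A (G.T₃ (x ⊗ₜ y))) := by
  obtain ⟨c, rfl⟩ := G.toDual_surjective b
  rw [act_toDual']; exact G.sliceAct_mul c x y

/-- `⟨a, b b'⟩ = ⟨b' ▷ a, b⟩ = ⟨Δ(a), b ⊗ b'⟩` for `b = φ( · c)` and `b' = φ( · d)`. -/
lemma eval_act_toDual (a c d : A) : G.eval (G.toDual c) (G.act (G.toDual d) a) =
    G.φ (G.slice ((G.Δ a).lmul (c ⊗ₜ d))) := by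
  rw [eval_toDual, act_toDual, slice_mul, T₁_mulRight]

lemma eval_act_eq (a c d : A) : G.eval (G.toDual c) (G.act (G.toDual d) a) =
    G.eval (G.toDual (G.slice (G.T₃.symm (c ⊗ₜ d)))) a := by
  rw [eval_act_toDual]
  obtain ⟨t, ht⟩ := G.T₃.surjective (c ⊗ₜ d)
  rw [← ht, LinearEquiv.symm_apply_apply]
  clear ht
  induction t with
  | zero => simp
  | add x y hx hy => simp only [map_add, LinearMap.add_apply, hx, hy]
  | tmul p q => rw [← T₃_mul, slice_T₃]; simp [mul_comm]

lemma mul_mem_range (b b' : G.Dual) :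
    G.eval b ∘ₗ G.act b' ∈ LinearMap.range G.dualMap := by
  obtain ⟨c, rfl⟩ := G.toDual_surjective b
  obtain ⟨d, rfl⟩ := G.toDual_surjective b'
  refine ⟨G.slice (G.T₃.symm (c ⊗ₜ d)), ?_⟩
  ext a
  exact (G.eval_act_eq a c d).symm

/-- The product of `B`, dual to the coproduct of `A`:
`⟨a, b b'⟩ = ⟨Δ(a), b ⊗ b'⟩ = ⟨(ι ⊗ ⟨ · , b'⟩)Δ(a), b⟩`. -/
instance : Mul G.Dual := ⟨fun b b' => ⟨G.eval b ∘ₗ G.act b', G.mul_mem_range b b'⟩⟩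

@[simp] lemma eval_mul (b b' : G.Dual) (a : A) : G.eval (b * b') a = G.eval b (G.act b' a) := rfl

lemma toDual_mul (c d : A) :
    G.toDual c * G.toDual d = G.toDual (G.slice (G.T₃.symm (c ⊗ₜ d))) := by
  apply G.eval_injective
  ext a
  rw [eval_mul, eval_act_eq]

/-- `s` and `x` are sent to `(ι ⊗ φ)(Δ(x) s)`. -/
def sliceΔ (s : A ⊗[ℂ] A) : A →ₗ[ℂ] A where
  toFun x := G.slice ((G.Δ x).lmul s)
  map_add' x y := by
    rw [map_add G.Δ x y]; exact map_add G.slice _ _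
  map_smul' r x := by
    rw [map_smul G.Δ r x]; exact map_smul G.slice r _

lemma sliceΔ_apply (s : A ⊗[ℂ] A) (x : A) : G.sliceΔ s x = G.slice ((G.Δ x).lmul s) := rfl

lemma sliceΔ_add (s t : A ⊗[ℂ] A) : G.sliceΔ (s + t) = G.sliceΔ s + G.sliceΔ t := by
  ext x; simp [sliceΔ_apply]

lemma sliceΔ_zero : G.sliceΔ 0 = 0 := by
  ext x; simp [sliceΔ_apply]

/-- `c ⊗ d ↦ Δ(d ▷ x)(c ⊗ 1)`, up to the identification of `d` with `φ( · d)`. -/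
def iter (x : A) : A ⊗[ℂ] A →ₗ[ℂ] A ⊗[ℂ] A :=
  G.T₁.toLinearMap ∘ₗ (G.sliceAct.flip x).rTensor A ∘ₗ (TensorProduct.comm ℂ A A).toLinearMap

lemma iter_tmul (x c d : A) : G.iter x (c ⊗ₜ d) = G.T₁ (G.sliceAct d x ⊗ₜ c) := rfl

lemma T₂_slice (y : A) (v : A ⊗[ℂ] A) : G.T₂ (y ⊗ₜ G.slice v) =
    G.slice.lTensor A (TensorProduct.assoc ℂ A A A
      (G.T₂.toLinearMap.rTensor A ((TensorProduct.assoc ℂ A A A).symm (y ⊗ₜ v)))) := by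
  induction v with
  | zero => simp
  | add u v hu hv => simp only [map_add, TensorProduct.tmul_add, hu, hv]
  | tmul u v =>
    simp only [slice_tmul, TensorProduct.tmul_smul, map_smul, TensorProduct.assoc_symm_tmul,
      LinearMap.rTensor_tmul, LinearEquiv.coe_coe]
    generalize G.T₂ (y ⊗ₜ u) = t
    induction t with
    | zero => simp
    | add u v hu hv => simp only [map_add, TensorProduct.add_tmul, smul_add, hu, hv]
    | tmul a b => simp

lemma mulLeft_iter (x y : A) (s : A ⊗[ℂ] A) :
    (LinearMap.mulLeft ℂ y).rTensor A (G.iter x s) =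
      (G.sliceΔ s).lTensor A (G.T₂ (y ⊗ₜ x)) := by
  induction s with
  | zero => simp [sliceΔ_zero]
  | add u v hu hv =>
    simp only [map_add, sliceΔ_add, LinearMap.lTensor_add, LinearMap.add_apply, hu, hv]
  | tmul c d =>
    rw [iter_tmul, ← T₂_T₁, sliceAct_apply, T₂_slice, G.coassoc]
    generalize G.T₂ (y ⊗ₜ x) = w
    induction w with
    | zero => simp
    | add u v hu hv => simp only [map_add, TensorProduct.add_tmul, hu, hv]
    | tmul r s =>
      simp only [TensorProduct.assoc_tmul, LinearMap.lTensor_tmul, LinearEquiv.coe_coe,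
        LinearMap.mulRight_apply, sliceΔ_apply]
      rw [slice_mul, T₁_mulRight]

lemma iter_T₃ (x : A) (t : A ⊗[ℂ] A) :
    G.iter x (G.T₃ t) = (G.sliceAct.flip x).rTensor A t := by
  induction t with
  | zero => simp
  | add u v hu hv => simp only [map_add, hu, hv]
  | tmul p q =>
    rw [← sub_eq_zero]
    apply rTensor_jointly_injective (fun a : A => LinearMap.mulLeft ℂ a)
      (fun x hx => G.nondegenerate.2 x hx)
    intro y
    rw [map_sub, sub_eq_zero, mulLeft_iter, LinearMap.rTensor_tmul, LinearMap.rTensor_tmul,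
      LinearMap.mulLeft_apply, LinearMap.flip_apply, sliceAct_apply, mul_slice, ← T₂_T₁]
    generalize G.T₂ (y ⊗ₜ x) = w
    induction w with
    | zero => simp
    | add u v hu hv => simp only [map_add, TensorProduct.add_tmul, hu, hv]
    | tmul r s =>
      simp only [LinearMap.lTensor_tmul, sliceΔ_apply, LinearMap.mulRight_apply, slice_tmul]
      rw [← T₃_mul, slice_T₃, TensorProduct.tmul_smul, TensorProduct.smul_tmul']

/-- `A` is a left module over `B`. -/
lemma act_mul (b b' : G.Dual) (x : A) : G.act (b * b') x = G.act b (G.act b' x) := by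
  obtain ⟨c, rfl⟩ := G.toDual_surjective b
  obtain ⟨d, rfl⟩ := G.toDual_surjective b'
  rw [toDual_mul, act_toDual' G _ x, act_toDual, act_toDual', ← iter_tmul]
  obtain ⟨t, ht⟩ := G.T₃.surjective (c ⊗ₜ d)
  rw [← ht, LinearEquiv.symm_apply_apply, iter_T₃]
  clear ht
  induction t with
  | zero => simp
  | add u v hu hv => simp only [map_add, LinearMap.add_apply, hu, hv]
  | tmul p q => simp

instance : NonUnitalRing G.Dual where
  left_distrib b c d := by
    apply G.eval_injective; ext a; simp
  right_distrib b c d := by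
    apply G.eval_injective; ext a; simp
  zero_mul b := by
    apply G.eval_injective; ext a; simp
  mul_zero b := by
    apply G.eval_injective; ext a; simp
  mul_assoc b c d := by
    apply G.eval_injective; ext a; simp [act_mul]

instance : IsScalarTower ℂ G.Dual G.Dual := ⟨fun r b c => by
  apply G.eval_injective; ext a
  simp only [smul_eq_mul, eval_mul, map_smul, LinearMap.smul_apply]⟩

instance : SMulCommClass ℂ G.Dual G.Dual := ⟨fun r b c => by
  apply G.eval_injective; ext a
  simp only [smul_eq_mul, eval_mul, map_smul, LinearMap.smul_apply]⟩

/-! ### The coproduct of the dual -/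

/-- The tensor product pairing of `B ⊗ B` with `A ⊗ A`. -/
def eval₂ : G.Dual ⊗[ℂ] G.Dual →ₗ[ℂ] Module.Dual ℂ (A ⊗[ℂ] A) :=
  TensorProduct.dualDistrib ℂ A A ∘ₗ TensorProduct.map G.eval G.eval

@[simp] lemma eval₂_tmul (b b' : G.Dual) (a a' : A) :
    G.eval₂ (b ⊗ₜ b') (a ⊗ₜ a') = G.eval b a * G.eval b' a' := rfl

lemma eval₂_injective : Function.Injective G.eval₂ := by
  rw [injective_iff_map_eq_zero]
  intro t ht
  apply rTensor_jointly_injective (fun a : A => G.eval.flip a)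
    (fun b hb => G.eval_injective (by ext a; simpa using hb a))
  intro a
  apply lTensor_jointly_injective (fun a : A => G.eval.flip a)
    (fun b hb => G.eval_injective (by ext a; simpa using hb a))
  intro a'
  have key : ∀ s : G.Dual ⊗[ℂ] G.Dual, (G.eval.flip a').lTensor ℂ ((G.eval.flip a).rTensor G.Dual s)
      = G.eval₂ s (a ⊗ₜ a') • ((1 : ℂ) ⊗ₜ[ℂ] (1 : ℂ)) := by
    intro s
    induction s with
    | zero => simp
    | add x y hx hy => simp only [map_add, LinearMap.add_apply, hx, hy, add_smul]
    | tmul x y =>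
      simp only [LinearMap.rTensor_tmul, LinearMap.lTensor_tmul, LinearMap.flip_apply, eval₂_tmul,
        TensorProduct.smul_tmul']
      rw [mul_comm, ← smul_smul, TensorProduct.smul_tmul]
      simp
  rw [key, ht]; simp

lemma eval₂_toDual (z s : A ⊗[ℂ] A) :
    G.eval₂ (TensorProduct.map G.toDual G.toDual s) z = G.φ (G.slice (z * s)) := by
  induction s with
  | zero => simp
  | add x y hx hy => simp only [map_add, LinearMap.add_apply, mul_add, hx, hy]
  | tmul c d =>
    induction z with
    | zero => simp
    | add x y hx hy => simp only [map_add, add_mul, hx, hy]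
    | tmul x y => simp [mul_comm]

lemma eval₂_T₂ (t : A ⊗[ℂ] A) :
    G.eval₂ (TensorProduct.map G.toDual G.toDual (G.T₃ t)) ∘ₗ G.T₂.toLinearMap =
      G.eval₂ (TensorProduct.map G.toDual G.toDual (TensorProduct.comm ℂ A A t)) := by
  apply TensorProduct.ext'
  intro x y
  rw [LinearMap.comp_apply, LinearEquiv.coe_coe, eval₂_toDual, T₂_mul, ← mul_slice]
  induction t with
  | zero => simp
  | add u v hu hv => simp only [map_add, LinearMap.add_apply, mul_add, hu, hv]
  | tmul p q =>
    rw [← T₃_mul, slice_T₃]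
    simp [mul_comm, mul_smul_comm]

lemma map_toDual_surjective :
    Function.Surjective (TensorProduct.map G.toDual G.toDual) :=
  TensorProduct.map_surjective G.toDual_surjective G.toDual_surjective

lemma eval₂_T₂_mem (s : G.Dual ⊗[ℂ] G.Dual) :
    G.eval₂ s ∘ₗ G.T₂.toLinearMap ∈ LinearMap.range G.eval₂ := by
  obtain ⟨s, rfl⟩ := G.map_toDual_surjective s
  obtain ⟨t, rfl⟩ := G.T₃.surjective s
  rw [eval₂_T₂]
  exact ⟨_, rfl⟩

/-- The map `b ⊗ b' ↦ Δ(b)(1 ⊗ b')` of `B ⊗ B`, where the coproduct of `B` is dual to the product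
of `A`. As `⟨a, x b'⟩ = ⟨b' ▷ a, x⟩`, it is given by
`⟨a ⊗ a', Δ(b)(1 ⊗ b')⟩ = ⟨a (b' ▷ a'), b⟩ = ⟨(a ⊗ 1)Δ(a'), b ⊗ b'⟩`. -/
def dualT₁ : G.Dual ⊗[ℂ] G.Dual →ₗ[ℂ] G.Dual ⊗[ℂ] G.Dual :=
  (LinearEquiv.ofInjective G.eval₂ G.eval₂_injective).symm.toLinearMap ∘ₗ
    LinearMap.codRestrict (LinearMap.range G.eval₂)
      (LinearMap.lcomp ℂ ℂ G.T₂.toLinearMap ∘ₗ G.eval₂) G.eval₂_T₂_mem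

lemma eval₂_dualT₁ (s : G.Dual ⊗[ℂ] G.Dual) (z : A ⊗[ℂ] A) :
    G.eval₂ (G.dualT₁ s) z = G.eval₂ s (G.T₂ z) := by
  have := LinearEquiv.apply_symm_apply (LinearEquiv.ofInjective G.eval₂ G.eval₂_injective)
    (LinearMap.codRestrict (LinearMap.range G.eval₂)
      (LinearMap.lcomp ℂ ℂ G.T₂.toLinearMap ∘ₗ G.eval₂) G.eval₂_T₂_mem s)
  exact congrArg (fun f => f.1 z) this

lemma dualT₁_T₃ (t : A ⊗[ℂ] A) : G.dualT₁ (TensorProduct.map G.toDual G.toDual (G.T₃ t)) =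
    TensorProduct.map G.toDual G.toDual (TensorProduct.comm ℂ A A t) := by
  apply G.eval₂_injective
  rw [← eval₂_T₂]
  ext1
  ext x y
  exact G.eval₂_dualT₁ _ _

/-! ### The Heisenberg algebra -/

/-- Left multiplication by `a ∈ A` on the Heisenberg algebra `A ⊗ B`:
`a (a' ⊗ b') = a a' ⊗ b'`. -/
def heisLeftA : A →ₗ[ℂ] Module.End ℂ (A ⊗[ℂ] G.Dual) :=
  LinearMap.rTensorHom G.Dual ∘ₗ LinearMap.mul ℂ A

/-- Left multiplication by `b ∈ B` on the Heisenberg algebra `A ⊗ B`: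
`b (a' ⊗ b') = ∑ ⟨a'₍₂₎, b₍₁₎⟩ a'₍₁₎ ⊗ b₍₂₎ b' = ∑ (b₍₁₎ ▷ a') ⊗ b₍₂₎ b'`. -/
def heisLeftB : G.Dual →ₗ[ℂ] Module.End ℂ (A ⊗[ℂ] G.Dual) where
  toFun b := TensorProduct.lift
    ((LinearMap.rTensorHom G.Dual ∘ₗ G.act.flip).compl₂ (G.dualT₁ ∘ₗ TensorProduct.mk ℂ _ _ b))
  map_add' b c := by
    apply TensorProduct.ext'; intro x y
    simp
  map_smul' r b := by
    apply TensorProduct.ext'; intro x y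
    simp

@[simp] lemma heisLeftA_tmul (a a' : A) (b' : G.Dual) :
    G.heisLeftA a (a' ⊗ₜ b') = (a * a') ⊗ₜ b' := rfl

lemma heisLeftB_tmul (b : G.Dual) (a' : A) (b' : G.Dual) :
    G.heisLeftB b (a' ⊗ₜ b') = (G.act.flip a').rTensor G.Dual (G.dualT₁ (b ⊗ₜ b')) := rfl

/-- The product of the Heisenberg algebra,
`(a ⊗ b)(a' ⊗ b') = ∑ ⟨a'₍₂₎, b₍₁₎⟩ a a'₍₁₎ ⊗ b₍₂₎ b'`, written as `(a ⊗ b) h = a (b h)`. -/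
def heisMul : A ⊗[ℂ] G.Dual →ₗ[ℂ] Module.End ℂ (A ⊗[ℂ] G.Dual) :=
  TensorProduct.lift
    ((LinearMap.mul ℂ (Module.End ℂ (A ⊗[ℂ] G.Dual))).compl₁₂ G.heisLeftA G.heisLeftB)

lemma heisMul_tmul (a : A) (b : G.Dual) (h : A ⊗[ℂ] G.Dual) :
    G.heisMul (a ⊗ₜ b) h = G.heisLeftA a (G.heisLeftB b h) := rfl

/-- The action of the Heisenberg algebra on `A`: `(a ⊗ b) ▷ x = a (b ▷ x)`. -/
def heisAct : A ⊗[ℂ] G.Dual →ₗ[ℂ] Module.End ℂ A :=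
  TensorProduct.lift
    ((LinearMap.mul ℂ (Module.End ℂ A)).compl₁₂ (LinearMap.mul ℂ A) G.act)

lemma heisAct_tmul (a : A) (b : G.Dual) (x : A) :
    G.heisAct (a ⊗ₜ b) x = a * G.act b x := rfl

lemma heisAct_mul_right (h : A ⊗[ℂ] G.Dual) : ∃ E : A ⊗[ℂ] A →ₗ[ℂ] A,
    (∀ x y, G.heisAct h x * y = E (G.T₃ (x ⊗ₜ y))) ∧
    (∀ u v, E (u ⊗ₜ v) = TensorProduct.rid ℂ A ((G.eval.flip v).lTensor A h) * u) := by
  induction h with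
  | zero => exact ⟨0, by simp, by simp⟩
  | add h k hh hk =>
    obtain ⟨E, h1, h2⟩ := hh
    obtain ⟨F, k1, k2⟩ := hk
    exact ⟨E + F, by simp [add_mul, h1, k1], by simp [add_mul, h2, k2]⟩
  | tmul a b =>
    refine ⟨LinearMap.mulLeft ℂ a ∘ₗ (TensorProduct.rid ℂ A).toLinearMap ∘ₗ
      (G.eval b).lTensor A, fun x y => ?_, fun u v => ?_⟩
    · rw [heisAct_tmul, mul_assoc, act_mul_right]; rfl
    · simp [smul_mul_assoc]

lemma heisAct_injective : Function.Injective G.heisAct := by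
  rw [injective_iff_map_eq_zero]
  intro h hh
  obtain ⟨E, h1, h2⟩ := G.heisAct_mul_right h
  have hE : E = 0 := by
    have : E ∘ₗ G.T₃.toLinearMap = 0 := by
      apply TensorProduct.ext'
      intro x y
      rw [LinearMap.comp_apply, LinearEquiv.coe_coe, ← h1, hh]; simp
    apply LinearMap.ext
    intro s
    obtain ⟨t, rfl⟩ := G.T₃.surjective s
    exact congrArg (fun f => f t) this
  apply lTensor_jointly_injective (fun a : A => G.eval.flip a)
    (fun b hb => G.eval_injective (by ext a; simpa using hb a))
  intro v
  apply (TensorProduct.rid ℂ A).injective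
  rw [map_zero]
  apply G.nondegenerate.1
  intro u
  rw [← h2, hE]; simp

lemma heisAct_heisLeftA (a : A) (h : A ⊗[ℂ] G.Dual) (x : A) :
    G.heisAct (G.heisLeftA a h) x = a * G.heisAct h x := by
  induction h with
  | zero => simp
  | add h k hh hk => simp only [map_add, LinearMap.add_apply, mul_add, hh, hk]
  | tmul a' b => rw [heisLeftA_tmul, heisAct_tmul, heisAct_tmul, mul_assoc]

/-- `b ▷ (a' (b' ▷ x)) = ∑ (b₍₁₎ ▷ a') (b₍₂₎ b' ▷ x)`. -/
lemma act_mul_act (b b' : G.Dual) (a' x : A) :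
    G.heisAct ((G.act.flip a').rTensor G.Dual (G.dualT₁ (b ⊗ₜ b'))) x =
      G.act b (a' * G.act b' x) := by
  obtain ⟨c, rfl⟩ := G.toDual_surjective b
  obtain ⟨d, rfl⟩ := G.toDual_surjective b'
  rw [act_toDual, act_toDual', T₁_mul, ← iter_tmul, ← TensorProduct.map_tmul]
  obtain ⟨t, ht⟩ := G.T₃.surjective (c ⊗ₜ d)
  rw [← ht, iter_T₃, dualT₁_T₃]
  clear ht
  induction t with
  | zero => simp
  | add u v hu hv => simp only [map_add, LinearMap.add_apply, hu, hv]
  | tmul p q =>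
    simp only [TensorProduct.comm_tmul, TensorProduct.map_tmul, LinearMap.rTensor_tmul,
      LinearMap.flip_apply]
    rw [heisAct_tmul, act_toDual, act_toDual', ← T₁_mulRight, ← slice_mul]

lemma heisAct_heisMul (h k : A ⊗[ℂ] G.Dual) (x : A) :
    G.heisAct (G.heisMul h k) x = G.heisAct h (G.heisAct k x) := by
  induction h with
  | zero => simp
  | add h h' hh hk => simp only [map_add, LinearMap.add_apply, hh, hk]
  | tmul a b =>
    rw [heisMul_tmul, heisAct_heisLeftA, heisAct_tmul]
    congr 1
    induction k with
    | zero => simp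
    | add h k hh hk => simp only [map_add, LinearMap.add_apply, hh, hk]
    | tmul a' b' => rw [heisLeftB_tmul, act_mul_act, heisAct_tmul]

lemma heisMul_assoc (h k l : A ⊗[ℂ] G.Dual) :
    G.heisMul (G.heisMul h k) l = G.heisMul h (G.heisMul k l) := by
  apply G.heisAct_injective; ext x; simp [heisAct_heisMul]

/-- The Heisenberg algebra `AB`: the space `A ⊗ B` with the product `heisMul`. -/
def Heisenberg : Type _ := A ⊗[ℂ] G.Dual

instance : AddCommGroup G.Heisenberg := inferInstanceAs (AddCommGroup (A ⊗[ℂ] G.Dual))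

instance : Module ℂ G.Heisenberg := inferInstanceAs (Module ℂ (A ⊗[ℂ] G.Dual))

instance : Mul G.Heisenberg := ⟨fun h k => G.heisMul h k⟩

instance : NonUnitalRing G.Heisenberg where
  left_distrib h k l := map_add (G.heisMul h) k l
  right_distrib h k l := LinearMap.map_add₂ G.heisMul h k l
  zero_mul h := LinearMap.map_zero₂ G.heisMul h
  mul_zero h := map_zero (G.heisMul h)
  mul_assoc := G.heisMul_assoc

instance : IsScalarTower ℂ G.Heisenberg G.Heisenberg :=
  ⟨fun r h k => LinearMap.map_smul₂ G.heisMul r h k⟩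

instance : SMulCommClass ℂ G.Heisenberg G.Heisenberg :=
  ⟨fun r h k => (map_smul (G.heisMul h) r k).symm⟩

/-- The embedding `j_A` of `A` in the multiplier algebra of `AB`, as left multiplications. -/
def jA : A →ₗ[ℂ] Module.End ℂ G.Heisenberg := G.heisLeftA

/-- The embedding `j_B` of `B` in the multiplier algebra of `AB`, as left multiplications. -/
def jB : G.Dual →ₗ[ℂ] Module.End ℂ G.Heisenberg := G.heisLeftB

/-! ### The duality `V` -/

/-- The left action of `A` on `B`: `⟨a', a ▷ b⟩ = ⟨a' a, b⟩`. -/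
def actDual : A →ₗ[ℂ] Module.End ℂ G.Dual where
  toFun a :=
    { toFun := fun b => ⟨G.eval b ∘ₗ LinearMap.mulRight ℂ a, by
        obtain ⟨c, rfl⟩ := G.toDual_surjective b
        exact ⟨a * c, by ext x; simp [mul_assoc]⟩⟩
      map_add' := fun b b' => by apply G.eval_injective; ext x; rfl
      map_smul' := fun r b => by apply G.eval_injective; ext x; rfl }
  map_add' a a' := by
    ext b; apply G.eval_injective; ext x
    change G.eval b (x * (a + a')) = G.eval b (x * a) + G.eval b (x * a')
    rw [mul_add, map_add]
  map_smul' r a := by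
    ext b; apply G.eval_injective; ext x
    change G.eval b (x * (r • a)) = r • G.eval b (x * a)
    rw [mul_smul_comm, map_smul]

lemma eval_actDual (a a' : A) (b : G.Dual) : G.eval (G.actDual a b) a' = G.eval b (a' * a) := rfl

/-- The functional `a ⊗ b ↦ ⟨a, b⟩` on `A ⊗ B`. -/
def pairing : Module.Dual ℂ (A ⊗[ℂ] G.Dual) := TensorProduct.lift G.eval.flip

/-- The tensor product pairing of `B ⊗ A` with `A ⊗ B`: `⟨b ⊗ a, a' ⊗ b'⟩ = ⟨a', b⟩ ⟨a, b'⟩`. -/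
def pairing₂ : G.Dual ⊗[ℂ] A →ₗ[ℂ] Module.Dual ℂ (A ⊗[ℂ] G.Dual) :=
  TensorProduct.dualDistrib ℂ A G.Dual ∘ₗ TensorProduct.map G.eval G.eval.flip

/-- The left action of `B ⊗ A` on `A ⊗ B`: `(b ⊗ a) ▷ (a' ⊗ b') = (b ▷ a') ⊗ (a ▷ b')`. It
satisfies `⟨c', c ▷ d⟩ = ⟨c' c, d⟩` for `c, c' ∈ B ⊗ A` and `d ∈ A ⊗ B`. -/
def actPairing : G.Dual ⊗[ℂ] A →ₗ[ℂ] Module.End ℂ (A ⊗[ℂ] G.Dual) :=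
  TensorProduct.homTensorHomMap (RingHom.id ℂ) A G.Dual A G.Dual ∘ₗ TensorProduct.map G.act G.actDual

lemma pairing₂_actPairing (c' c : G.Dual ⊗[ℂ] A) (d : A ⊗[ℂ] G.Dual) :
    G.pairing₂ c' (G.actPairing c d) = G.pairing₂ (c' * c) d := by
  induction c' with
  | zero => simp
  | add x y hx hy => simp only [map_add, LinearMap.add_apply, add_mul, hx, hy]
  | tmul b' a' =>
    induction c with
    | zero => simp
    | add x y hx hy => simp only [map_add, LinearMap.add_apply, mul_add, hx, hy]
    | tmul b a =>
      induction d with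
      | zero => simp
      | add x y hx hy => simp only [map_add, hx, hy]
      | tmul x y => rw [Algebra.TensorProduct.tmul_mul_tmul]; rfl

/-- `f` is the functional `⟨m, · ⟩` on `A ⊗ B` given by the extension to `M(B ⊗ A) × (A ⊗ B)` of
the pairing of `B ⊗ A` with `A ⊗ B`. As the action of `B ⊗ A` on `A ⊗ B` is unital, the
extension is determined by `⟨m, c ▷ d⟩ = ⟨m c, d⟩`. -/
def IsExtendedPairing (m : Multiplier (G.Dual ⊗[ℂ] A)) (f : Module.Dual ℂ (A ⊗[ℂ] G.Dual)) :
    Prop :=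
  ∀ c d, f (G.actPairing c d) = G.pairing₂ (m.lmul c) d

/-- `V` is the duality: `⟨V, a ⊗ b⟩ = ⟨a, b⟩` for all `a ∈ A` and `b ∈ B`. -/
def IsDuality (V : Multiplier (G.Dual ⊗[ℂ] A)) : Prop := G.IsExtendedPairing V G.pairing

/-! ### The actions of `B ⊗ A` -/

/-- The action of `B ⊗ A` on `A ⊗ A`: `(b ⊗ a) ▷ (x ⊗ x') = (b ▷ x) ⊗ a x'`. -/
def actTensor : G.Dual ⊗[ℂ] A →ₗ[ℂ] Module.End ℂ (A ⊗[ℂ] A) :=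
  TensorProduct.homTensorHomMap (RingHom.id ℂ) A A A A ∘ₗ TensorProduct.map G.act (LinearMap.mul ℂ A)

/-- Left multiplication by `b ⊗ j_A(a) ⊗ 1` on `B ⊗ AB ⊗ A`. -/
def leg₁₂ : G.Dual ⊗[ℂ] A →ₗ[ℂ] Module.End ℂ (G.Dual ⊗[ℂ] (G.Heisenberg ⊗[ℂ] A)) :=
  TensorProduct.homTensorHomMap (RingHom.id ℂ) G.Dual (G.Heisenberg ⊗[ℂ] A) G.Dual (G.Heisenberg ⊗[ℂ] A) ∘ₗ
    TensorProduct.map (LinearMap.mul ℂ G.Dual) (LinearMap.rTensorHom A ∘ₗ G.jA)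

/-- Left multiplication by `b ⊗ 1 ⊗ a` on `B ⊗ AB ⊗ A`. -/
def leg₁₃ : G.Dual ⊗[ℂ] A →ₗ[ℂ] Module.End ℂ (G.Dual ⊗[ℂ] (G.Heisenberg ⊗[ℂ] A)) :=
  TensorProduct.homTensorHomMap (RingHom.id ℂ) G.Dual (G.Heisenberg ⊗[ℂ] A) G.Dual (G.Heisenberg ⊗[ℂ] A) ∘ₗ
    TensorProduct.map (LinearMap.mul ℂ G.Dual)
      (LinearMap.lTensorHom G.Heisenberg ∘ₗ LinearMap.mul ℂ A)

/-- Left multiplication by `1 ⊗ j_B(b) ⊗ a` on `B ⊗ AB ⊗ A`. -/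
def leg₂₃ : G.Dual ⊗[ℂ] A →ₗ[ℂ] Module.End ℂ (G.Dual ⊗[ℂ] (G.Heisenberg ⊗[ℂ] A)) :=
  LinearMap.lTensorHom G.Dual ∘ₗ
    TensorProduct.homTensorHomMap (RingHom.id ℂ) G.Heisenberg A G.Heisenberg A ∘ₗ
      TensorProduct.map G.jB (LinearMap.mul ℂ A)

end AlgebraicQuantumGroup

section Extensions

variable {C X D : Type*} [NonUnitalRing C] [Module ℂ C] [IsScalarTower ℂ C C] [SMulCommClass ℂ C C]
  [AddCommGroup X] [Module ℂ X]
  [NonUnitalRing D] [Module ℂ D] [IsScalarTower ℂ D D] [SMulCommClass ℂ D D]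

/-- `σ` is an extension of the action `ρ` of `C` on `X` to a unital action of `M(C)`. -/
def ExtendsAction (ρ : C →ₗ[ℂ] Module.End ℂ X) (σ : Multiplier C →ₐ[ℂ] Module.End ℂ X) : Prop :=
  ∀ c, σ (.of c) = ρ c

/-- `θ : M(C) → M(D)` is a unital homomorphism extending the homomorphism `C → M(D)` for which
`c ∈ C` is sent to the multiplier of `D` whose left multiplication is `ρ c`. -/
def ExtendsHom (ρ : C →ₗ[ℂ] Module.End ℂ D) (θ : Multiplier C →ₐ[ℂ] Multiplier D) : Prop :=
  ∀ c, (θ (.of c)).lmul = ρ c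

end Extensions

end

/-!
Everything rests on the canonical map `T₁ (x ⊗ y) = Δ(x)(1 ⊗ y)`. The element `V` is built from
the integral: left multiplication by `V` sends `φ(· c) ⊗ a` to `∑ φ(· p) ⊗ q`, where
`∑ Δ(p)(q ⊗ 1) = a ⊗ c`, and right multiplication is the analogous map for the right integral
`ψ = φ ∘ S`. The two descriptions fit together because every `φ(· c)` is of the form `ψ(c' ·)`, a
consequence of `S ((ι ⊗ φ)(Δ(a)(1 ⊗ c))) = (ι ⊗ φ)((1 ⊗ a)Δ(c))`. The dual has a non-degenerate
product since `φ` is faithful: the counit vanishes on the two-sided ideal of elements annihilated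
by all of `B`, which forces this ideal to be zero.

On `A ⊗ A` the multiplier `V` acts as `T₁`. The algebra `B ⊗ AB ⊗ A` acts faithfully on
`A ⊗ A ⊗ A`, and there the three legs of `V` act as the three copies of `T₁`, whose pentagon
equation is coassociativity of `Δ`.
-/

noncomputable section

section Slices

variable {R X Y X' Y' : Type*} [CommSemiring R] [AddCommMonoid X] [Module R X]
  [AddCommMonoid Y] [Module R Y] [AddCommMonoid X'] [Module R X'] [AddCommMonoid Y'] [Module R Y']

/-- The slice map `ι ⊗ f`. -/
def sliceR (f : Module.Dual R Y) : X ⊗[R] Y →ₗ[R] X :=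
  (TensorProduct.rid R X).toLinearMap ∘ₗ f.lTensor X

/-- The slice map `f ⊗ ι`. -/
def sliceL (f : Module.Dual R X) : X ⊗[R] Y →ₗ[R] Y :=
  (TensorProduct.lid R Y).toLinearMap ∘ₗ f.rTensor Y

@[simp] lemma sliceR_tmul (f : Module.Dual R Y) (x : X) (y : Y) :
    sliceR f (x ⊗ₜ y) = f y • x := by simp [sliceR]

@[simp] lemma sliceL_tmul (f : Module.Dual R X) (x : X) (y : Y) :
    sliceL f (x ⊗ₜ y) = f x • y := by simp [sliceL]

lemma sliceR_lTensor (f : Module.Dual R Y') (g : Y →ₗ[R] Y') (t : X ⊗[R] Y) :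
    sliceR f (g.lTensor X t) = sliceR (f ∘ₗ g) t := by
  induction t <;> simp_all

lemma sliceL_rTensor (f : Module.Dual R X') (g : X →ₗ[R] X') (t : X ⊗[R] Y) :
    sliceL f (g.rTensor Y t) = sliceL (f ∘ₗ g) t := by
  induction t <;> simp_all

lemma sliceR_rTensor (f : Module.Dual R Y) (g : X →ₗ[R] X') (t : X ⊗[R] Y) :
    sliceR f (g.rTensor Y t) = g (sliceR f t) := by
  induction t <;> simp_all

lemma sliceL_lTensor (f : Module.Dual R X) (g : Y →ₗ[R] Y') (t : X ⊗[R] Y) :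
    sliceL f (g.lTensor X t) = g (sliceL f t) := by
  induction t <;> simp_all

lemma sliceR_comm (f : Module.Dual R X) (t : X ⊗[R] Y) :
    sliceR f (TensorProduct.comm R X Y t) = sliceL f t := by
  induction t <;> simp_all

lemma apply_sliceR (f : Module.Dual R Y) (g : Module.Dual R X) (t : X ⊗[R] Y) :
    g (sliceR f t) = f (sliceL g t) := by
  induction t <;> simp_all [mul_comm]

lemma lTensor_mk_flip (y : Y) (t : X ⊗[R] X') :
    ((TensorProduct.mk R X' Y).flip y).lTensor X t =
      TensorProduct.assoc R X X' Y (t ⊗ₜ y) := by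
  induction t <;> simp_all [TensorProduct.add_tmul]

lemma lTensor_sliceL_assoc (f : Module.Dual R X') (t : (X ⊗[R] X') ⊗[R] Y) :
    (sliceL f).lTensor X (TensorProduct.assoc R X X' Y t) = (sliceR f).rTensor Y t := by
  refine DFunLike.congr_fun
    (f := (sliceL f).lTensor X ∘ₗ (TensorProduct.assoc R X X' Y).toLinearMap)
    (TensorProduct.ext_threefold fun x x' y => ?_) t
  simp [TensorProduct.smul_tmul]

end Slices

section FieldSlices

variable {K X Y Z : Type*} [Field K] [AddCommGroup X] [Module K X] [AddCommGroup Y] [Module K Y]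
  [AddCommGroup Z] [Module K Z]

lemma sliceR_surjective {f : Module.Dual K Y} (hf : f ≠ 0) :
    Function.Surjective (sliceR f : X ⊗[K] Y →ₗ[K] X) := by
  obtain ⟨y, hy⟩ := DFunLike.ne_iff.1 hf
  exact fun x => ⟨(f y)⁻¹ • x ⊗ₜ y, by rw [map_smul, sliceR_tmul, inv_smul_smul₀ hy]⟩

lemma sliceL_surjective {f : Module.Dual K X} (hf : f ≠ 0) :
    Function.Surjective (sliceL f : X ⊗[K] Y →ₗ[K] Y) := by
  obtain ⟨x, hx⟩ := DFunLike.ne_iff.1 hf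
  exact fun y => ⟨(f x)⁻¹ • x ⊗ₜ y, by rw [map_smul, sliceL_tmul, inv_smul_smul₀ hx]⟩

lemma map_eq_zero_of_sliceL_eq_zero {ι : Type*} (f : ι → Module.Dual K X) (h : X ⊗[K] Y →ₗ[K] Z)
    (hh : ∀ x, (∀ i, f i x = 0) → ∀ y, h (x ⊗ₜ y) = 0) {t : X ⊗[K] Y}
    (ht : ∀ i, sliceL (f i) t = 0) : h t = 0 := by
  classical
  let b := Module.Basis.ofVectorSpace K Y
  have repr_sliceL (i k) (s : X ⊗[K] Y) : b.repr (sliceL (f i) s) k =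
      f i (TensorProduct.equivFinsuppOfBasisRight b s k) := by
    induction s <;> simp_all [mul_comm]
  rw [← (TensorProduct.equivFinsuppOfBasisRight b).symm_apply_apply t,
    TensorProduct.equivFinsuppOfBasisRight_symm_apply, Finsupp.sum, map_sum]
  exact Finset.sum_eq_zero fun k _ => hh _ (fun i => by rw [← repr_sliceL, ht, map_zero]; rfl) _

end FieldSlices

section LeftLegs

variable {A : Type*} [NonUnitalRing A] [Module ℂ A] [SMulCommClass ℂ A A]

/-- Left multiplication by `c ⊗ 1`. -/
abbrev mulL₁ (c : A) : Module.End ℂ (A ⊗[ℂ] A) := (LinearMap.mulLeft ℂ c).rTensor A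

/-- Left multiplication by `1 ⊗ c`. -/
abbrev mulL₂ (c : A) : Module.End ℂ (A ⊗[ℂ] A) := (LinearMap.mulLeft ℂ c).lTensor A

lemma sliceR_mulL₁ (f : Module.Dual ℂ A) (c : A) (t : A ⊗[ℂ] A) :
    sliceR f (mulL₁ c t) = c * sliceR f t := sliceR_rTensor ..

lemma sliceL_mulL₂ (f : Module.Dual ℂ A) (c : A) (t : A ⊗[ℂ] A) :
    sliceL f (mulL₂ c t) = c * sliceL f t := sliceL_lTensor ..

end LeftLegs

section RightLegs

variable {A : Type*} [NonUnitalRing A] [Module ℂ A] [IsScalarTower ℂ A A]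

/-- Right multiplication by `c ⊗ 1`. -/
abbrev mulR₁ (c : A) : Module.End ℂ (A ⊗[ℂ] A) := (LinearMap.mulRight ℂ c).rTensor A

/-- Right multiplication by `1 ⊗ c`. -/
abbrev mulR₂ (c : A) : Module.End ℂ (A ⊗[ℂ] A) := (LinearMap.mulRight ℂ c).lTensor A

lemma sliceR_mulR₁ (f : Module.Dual ℂ A) (c : A) (t : A ⊗[ℂ] A) :
    sliceR f (mulR₁ c t) = sliceR f t * c := sliceR_rTensor ..

lemma sliceL_mulR₂ (f : Module.Dual ℂ A) (c : A) (t : A ⊗[ℂ] A) :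
    sliceL f (mulR₂ c t) = sliceL f t * c := sliceL_lTensor ..

end RightLegs

section MulTensor

variable {A : Type*} [NonUnitalRing A] [Module ℂ A] [IsScalarTower ℂ A A] [SMulCommClass ℂ A A]

lemma mul'_mulL₁ (c : A) (t : A ⊗[ℂ] A) :
    LinearMap.mul' ℂ A (mulL₁ c t) = c * LinearMap.mul' ℂ A t := by
  induction t <;> simp_all [mul_add, mul_assoc]

lemma mul'_mulR₂ (c : A) (t : A ⊗[ℂ] A) :
    LinearMap.mul' ℂ A (mulR₂ c t) = LinearMap.mul' ℂ A t * c := by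
  induction t <;> simp_all [add_mul, mul_assoc]

end MulTensor

namespace Multiplier

variable {A : Type*} [NonUnitalRing A] [Module ℂ A] [IsScalarTower ℂ A A] [SMulCommClass ℂ A A]

lemma of_mul (hA : IsNondegenerateProduct A) (m : Multiplier A) (a : A) :
    of a * m = of (m.rmul a) := by
  refine ext' (LinearMap.ext fun b => m.compat a b) (LinearMap.ext fun b => ?_)
  refine sub_eq_zero.1 (hA.1 _ fun c => ?_)
  simp [sub_mul, mul_assoc, ← compat]

variable {C : Type*} [NonUnitalRing C] [Module ℂ C] [IsScalarTower ℂ C C] [SMulCommClass ℂ C C]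

lemma tmul_mul_tmul (m m' : Multiplier A) (n n' : Multiplier C) :
    tmul m n * tmul m' n' = tmul (m * m') (n * n') :=
  ext' (TensorProduct.ext' fun _ _ => rfl) (TensorProduct.ext' fun _ _ => rfl)

lemma of_mul_of (a b : A) : of a * of b = of (a * b) :=
  ext' (LinearMap.ext fun c => (mul_assoc a b c).symm) (LinearMap.ext fun c => mul_assoc c a b)

lemma of_tmul (a : A) (c : C) : of (a ⊗ₜ[ℂ] c) = tmul (of a) (of c) :=
  ext' (TensorProduct.ext' fun _ _ => by simp [tmul]) (TensorProduct.ext' fun _ _ => by simp [tmul])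

end Multiplier

namespace AlgebraicQuantumGroup

variable {A : Type*} [NonUnitalRing A] [Module ℂ A] [IsScalarTower ℂ A A] [SMulCommClass ℂ A A]
variable (G : AlgebraicQuantumGroup A)

open Multiplier

section
include G

lemma mul_left_ext {a b : A} (h : ∀ c, c * a = c * b) : a = b :=
  sub_eq_zero.1 <| G.nondegenerate.2 _ fun c => by rw [mul_sub, h, sub_self]

lemma mul_right_ext {a b : A} (h : ∀ c, a * c = b * c) : a = b :=
  sub_eq_zero.1 <| G.nondegenerate.1 _ fun c => by rw [sub_mul, h, sub_self]

lemma mulL₁_ext {s t : A ⊗[ℂ] A} (h : ∀ c, mulL₁ c s = mulL₁ c t) : s = t :=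
  sub_eq_zero.1 <| rTensor_jointly_injective (LinearMap.mulLeft ℂ) G.nondegenerate.2 _
    fun c => by rw [map_sub, h, sub_self]

lemma mulR₂_ext {s t : A ⊗[ℂ] A} (h : ∀ c, mulR₂ c s = mulR₂ c t) : s = t :=
  sub_eq_zero.1 <| lTensor_jointly_injective (LinearMap.mulRight ℂ) G.nondegenerate.1 _
    fun c => by rw [map_sub, h, sub_self]

lemma of_mulL₁ (c : A) (t : A ⊗[ℂ] A) : of (mulL₁ c t) = tmul (of c) 1 * of t :=
  (mul_of G.nondegenerate₂ (tmul (of c) 1) t).symm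

lemma of_mulL₂ (c : A) (t : A ⊗[ℂ] A) : of (mulL₂ c t) = tmul 1 (of c) * of t :=
  (mul_of G.nondegenerate₂ (tmul 1 (of c)) t).symm

lemma of_mulR₁ (c : A) (t : A ⊗[ℂ] A) : of (mulR₁ c t) = of t * tmul (of c) 1 :=
  (of_mul G.nondegenerate₂ (tmul (of c) 1) t).symm

lemma of_mulR₂ (c : A) (t : A ⊗[ℂ] A) : of (mulR₂ c t) = of t * tmul 1 (of c) :=
  (of_mul G.nondegenerate₂ (tmul 1 (of c)) t).symm

end

/-! ### The canonical maps as bimodule maps -/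

lemma mulR₁_T₂ (a b c : A) : mulR₁ c (G.T₂ (a ⊗ₜ b)) = mulL₁ a (G.T₃ (b ⊗ₜ c)) := by
  apply of_injective G.nondegenerate₂
  rw [G.of_mulR₁, G.of_mulL₁, ← T₂_spec, ← T₃_spec, mul_assoc]

lemma mulR₂_T₄ (a b c : A) : mulR₂ c (G.T₄ (a ⊗ₜ b)) = mulL₂ a (G.T₁ (b ⊗ₜ c)) := by
  apply of_injective G.nondegenerate₂
  rw [G.of_mulR₂, G.of_mulL₂, ← T₄_spec, ← T₁_spec, mul_assoc]

lemma mulR₁_T₄ (a b c : A) : mulR₁ c (G.T₄ (a ⊗ₜ b)) = mulL₂ a (G.T₃ (b ⊗ₜ c)) := by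
  apply of_injective G.nondegenerate₂
  rw [G.of_mulR₁, G.of_mulL₂, ← T₄_spec, ← T₃_spec, mul_assoc]

lemma mulL₁_T₄ (a b c : A) : mulL₁ c (G.T₄ (a ⊗ₜ b)) = (G.Δ b).rmul (c ⊗ₜ a) := by
  apply of_injective G.nondegenerate₂
  rw [G.of_mulL₁, ← T₄_spec, ← of_mul G.nondegenerate₂, ← mul_assoc, of_tmul, tmul_mul_tmul,
    mul_one, one_mul]

lemma T₁_mulL₁ (a : A) (t : A ⊗[ℂ] A) : G.T₁ (mulL₁ a t) = (G.Δ a).lmul (G.T₁ t) := by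
  induction t with
  | zero => simp
  | add s t hs ht => simp only [map_add, hs, ht]
  | tmul b c => exact G.T₁_mul a b c

lemma T₁_mulR₂ (d : A) (t : A ⊗[ℂ] A) : G.T₁ (mulR₂ d t) = mulR₂ d (G.T₁ t) := by
  induction t with
  | zero => simp
  | add s t hs ht => simp only [map_add, hs, ht]
  | tmul b c =>
    apply of_injective G.nondegenerate₂
    rw [G.of_mulR₂, ← T₁_spec, mul_assoc, tmul_mul_tmul, of_mul_of, one_mul]
    exact (G.T₁_spec _ _).symm

lemma T₂_mulL₁ (a : A) (t : A ⊗[ℂ] A) : G.T₂ (mulL₁ a t) = mulL₁ a (G.T₂ t) := by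
  induction t with
  | zero => simp
  | add s t hs ht => simp only [map_add, hs, ht]
  | tmul b c =>
    apply of_injective G.nondegenerate₂
    rw [G.of_mulL₁, ← T₂_spec, ← mul_assoc, tmul_mul_tmul, of_mul_of, one_mul]
    exact (G.T₂_spec _ _).symm

lemma T₂_mulR₂ (d : A) (t : A ⊗[ℂ] A) : G.T₂ (mulR₂ d t) = (G.Δ d).rmul (G.T₂ t) := by
  induction t with
  | zero => simp
  | add s t hs ht => simp only [map_add, hs, ht]
  | tmul b c =>
    apply of_injective G.nondegenerate₂
    rw [← of_mul G.nondegenerate₂, ← T₂_spec, mul_assoc, ← map_mul]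
    exact (G.T₂_spec _ _).symm

lemma T₄_mulR₂ (d : A) (t : A ⊗[ℂ] A) : G.T₄ (mulR₂ d t) = (G.Δ d).rmul (G.T₄ t) := by
  induction t with
  | zero => simp
  | add s t hs ht => simp only [map_add, hs, ht]
  | tmul b c =>
    apply of_injective G.nondegenerate₂
    rw [← of_mul G.nondegenerate₂, ← T₄_spec, mul_assoc, ← map_mul]
    exact (G.T₄_spec _ _).symm

lemma rmul_ext {s t : A ⊗[ℂ] A} (h : ∀ d, (G.Δ d).rmul s = (G.Δ d).rmul t) : s = t := by
  refine sub_eq_zero.1 (G.nondegenerate₂.1 _ fun u => ?_)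
  obtain ⟨w, rfl⟩ := G.T₁.surjective u
  rw [sub_mul, sub_eq_zero]
  induction w with
  | zero => simp
  | add v w hv hw => simp only [map_add, mul_add, hv, hw]
  | tmul b c =>
    have hb : of s * G.Δ b = of t * G.Δ b := by
      rw [of_mul G.nondegenerate₂, of_mul G.nondegenerate₂, h]
    apply of_injective G.nondegenerate₂
    rw [← of_mul_of, ← of_mul_of, ← T₁_spec, ← mul_assoc, ← mul_assoc, hb]

/-! ### Coassociativity -/

/-- `v ↦ (z ⊗ 1 ⊗ 1)(Δ ⊗ ι)(v)`. -/
def comulL (z : A) : A ⊗[ℂ] A →ₗ[ℂ] A ⊗[ℂ] (A ⊗[ℂ] A) :=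
  (TensorProduct.assoc ℂ A A A).toLinearMap ∘ₗ
    (G.T₂.toLinearMap ∘ₗ TensorProduct.mk ℂ A A z).rTensor A

lemma comulL_tmul (z a b : A) :
    G.comulL z (a ⊗ₜ b) = TensorProduct.assoc ℂ A A A (G.T₂ (z ⊗ₜ a) ⊗ₜ b) := rfl

lemma comulL_T₁ (z : A) (t : A ⊗[ℂ] A) :
    G.comulL z (G.T₁ t) = G.T₁.toLinearMap.lTensor A (G.comulL z t) := by
  induction t with
  | zero => simp
  | add s t hs ht => simp only [map_add, hs, ht]
  | tmul b c =>
    rw [comulL_tmul, ← G.coassoc]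
    generalize G.T₁ (b ⊗ₜ c) = v
    induction v <;> simp_all [comulL, TensorProduct.tmul_add]

lemma lTensor_sliceL_comulL (f : Module.Dual ℂ A) (z : A) (t : A ⊗[ℂ] A) :
    (sliceL f).lTensor A (G.comulL z t) =
      (sliceR f ∘ₗ G.T₂.toLinearMap ∘ₗ TensorProduct.mk ℂ A A z).rTensor A t := by
  rw [comulL, LinearMap.comp_apply, LinearEquiv.coe_coe, lTensor_sliceL_assoc,
    LinearMap.rTensor_comp_apply _ (sliceR f)]

/-! ### The counit -/

lemma slice_eq_sliceR (t : A ⊗[ℂ] A) : G.slice t = sliceR G.φ t := rfl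

lemma slice_surjective : Function.Surjective G.slice := sliceR_surjective G.φ_ne_zero

lemma exists_slice_T₁_section :
    ∃ g : A →ₗ[ℂ] A ⊗[ℂ] A, ∀ x, G.slice (G.T₁ (g x)) = x := by
  obtain ⟨g, hg⟩ := (G.slice ∘ₗ G.T₁.toLinearMap).exists_rightInverse_of_surjective
    (LinearMap.range_eq_top.2 (G.slice_surjective.comp G.T₁.surjective))
  exact ⟨g, LinearMap.congr_fun hg⟩

lemma T₁_symm_rTensor_sliceAct (a : A) (t : A ⊗[ℂ] A) :
    G.T₁.symm ((G.sliceAct.flip a).rTensor A t) =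
      (G.sliceAct.flip a).rTensor A (TensorProduct.comm ℂ A A (G.T₃ t)) := by
  rw [LinearEquiv.symm_apply_eq, ← iter_T₃]
  rfl

lemma T₁_symm_slice_T₁ (a c y : A) : G.T₁.symm (G.slice (G.T₁ (a ⊗ₜ c)) ⊗ₜ y) =
    (G.sliceAct.flip a).rTensor A (TensorProduct.comm ℂ A A (G.T₃ (c ⊗ₜ y))) :=
  G.T₁_symm_rTensor_sliceAct a (c ⊗ₜ y)

lemma mul'_rTensor_sliceAct (a : A) (t : A ⊗[ℂ] A) :
    LinearMap.mul' ℂ A ((G.sliceAct.flip a).rTensor A (TensorProduct.comm ℂ A A t)) =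
      G.slice ((G.Δ a).lmul t) := by
  induction t with
  | zero => simp
  | add s t hs ht => simp only [map_add, hs, ht]
  | tmul u v => simp [sliceAct_apply, slice_mul, T₁_mulRight]

lemma mul'_T₁_symm_slice_T₁ (t : A ⊗[ℂ] A) (y : A) :
    LinearMap.mul' ℂ A (G.T₁.symm (G.slice (G.T₁ t) ⊗ₜ y)) =
      G.φ (LinearMap.mul' ℂ A t) • y := by
  induction t with
  | zero => simp
  | add s t hs ht => simp only [map_add, TensorProduct.add_tmul, add_smul, hs, ht]
  | tmul a c =>
    rw [T₁_symm_slice_T₁, mul'_rTensor_sliceAct, ← T₃_mul, slice_T₃, LinearMap.mul'_apply]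

lemma exists_counit : ∃ ε : Module.Dual ℂ A, ∀ x y,
    LinearMap.mul' ℂ A (G.T₁.symm (x ⊗ₜ y)) = ε x • y := by
  obtain ⟨g, hg⟩ := G.exists_slice_T₁_section
  refine ⟨G.φ ∘ₗ LinearMap.mul' ℂ A ∘ₗ g, fun x y => ?_⟩
  conv_lhs => rw [← hg x]
  exact G.mul'_T₁_symm_slice_T₁ _ _

/-- The counit `ε`, for which `(ε ⊗ ι)(Δ(a)(1 ⊗ b)) = ab`. -/
def counit : Module.Dual ℂ A := G.exists_counit.choose

lemma mul'_T₁_symm (x y : A) :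
    LinearMap.mul' ℂ A (G.T₁.symm (x ⊗ₜ y)) = G.counit x • y := G.exists_counit.choose_spec x y

lemma sliceL_counit (t : A ⊗[ℂ] A) :
    sliceL G.counit t = LinearMap.mul' ℂ A (G.T₁.symm t) := by
  induction t <;> simp_all [mul'_T₁_symm]

lemma sliceL_counit_T₁ (t : A ⊗[ℂ] A) : sliceL G.counit (G.T₁ t) = LinearMap.mul' ℂ A t := by
  rw [sliceL_counit, LinearEquiv.symm_apply_apply]

lemma counit_slice_T₁ (a c : A) : G.counit (G.slice (G.T₁ (a ⊗ₜ c))) = G.φ (a * c) := by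
  rw [slice_eq_sliceR, apply_sliceR, sliceL_counit_T₁, LinearMap.mul'_apply]

lemma exists_φ_eq_one : ∃ a, G.φ a = 1 := by
  obtain ⟨a, ha⟩ := DFunLike.ne_iff.1 G.φ_ne_zero
  exact ⟨(G.φ a)⁻¹ • a, by rw [map_smul, smul_eq_mul, inv_mul_cancel₀ ha]⟩

lemma T₁_symm_mulR₁_T₁ (m n u : A) :
    G.T₁.symm (mulR₁ u (G.T₁ (m ⊗ₜ n))) = mulL₁ m (G.T₁.symm (u ⊗ₜ n)) := by
  rw [LinearEquiv.symm_apply_eq, T₁_mulL₁, LinearEquiv.apply_symm_apply, T₁_mulRight]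

lemma sliceL_counit_mulR₁ (u : A) (t : A ⊗[ℂ] A) :
    sliceL G.counit (mulR₁ u t) = G.counit u • sliceL G.counit t := by
  obtain ⟨w, rfl⟩ := G.T₁.surjective t
  induction w with
  | zero => simp
  | add s t hs ht => simp only [map_add, smul_add, hs, ht]
  | tmul m n =>
    rw [sliceL_counit, T₁_symm_mulR₁_T₁, mul'_mulL₁, mul'_T₁_symm, sliceL_counit_T₁,
      LinearMap.mul'_apply, mul_smul_comm]

lemma counit_mul (a b : A) : G.counit (a * b) = G.counit a * G.counit b := by
  obtain ⟨c, hc⟩ := G.exists_φ_eq_one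
  simpa [hc, mul_comm] using congrArg G.φ (G.sliceL_counit_mulR₁ b (a ⊗ₜ c))

lemma rTensor_sliceR_counit_T₂ (z : A) (t : A ⊗[ℂ] A) :
    (sliceR G.counit ∘ₗ G.T₂.toLinearMap ∘ₗ TensorProduct.mk ℂ A A z).rTensor A t = mulL₁ z t := by
  obtain ⟨w, rfl⟩ := G.T₁.surjective t
  have h : sliceL G.counit ∘ₗ G.T₁.toLinearMap = LinearMap.mul' ℂ A :=
    LinearMap.ext G.sliceL_counit_T₁
  rw [← lTensor_sliceL_comulL, comulL_T₁, ← LinearMap.lTensor_comp_apply, h]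
  induction w with
  | zero => simp
  | add s t hs ht => simp only [map_add, hs, ht]
  | tmul b c =>
    rw [comulL_tmul, ← lTensor_mk_flip, ← LinearMap.lTensor_comp_apply, ← T₂_T₁]
    rfl

lemma sliceR_counit_T₂ (z c : A) : sliceR G.counit (G.T₂ (z ⊗ₜ c)) = z * c := by
  obtain ⟨a, ha⟩ := G.exists_φ_eq_one
  simpa [ha] using congrArg (sliceR G.φ) (G.rTensor_sliceR_counit_T₂ z (c ⊗ₜ a))

/-! ### The antipode -/

lemma sliceL_counit_T₁_symm_slice_T₁ (t : A ⊗[ℂ] A) (y : A) :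
    sliceL G.counit (G.T₁.symm (G.slice (G.T₁ t) ⊗ₜ y)) = G.slice (G.T₄ t) * y := by
  induction t with
  | zero => simp
  | add s t hs ht => simp only [map_add, TensorProduct.add_tmul, add_mul, hs, ht]
  | tmul a c =>
    have h : G.counit ∘ₗ G.sliceAct.flip a = G.φ ∘ₗ LinearMap.mulLeft ℂ a :=
      LinearMap.ext (G.counit_slice_T₁ a)
    rw [T₁_symm_slice_T₁, sliceL_rTensor, h, slice_mul, mulR₁_T₄, slice_eq_sliceR, sliceR_lTensor,
      ← sliceR_comm, TensorProduct.comm_comm]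

lemma exists_antipode :
    ∃ S : A →ₗ[ℂ] A, ∀ x y, S x * y = sliceL G.counit (G.T₁.symm (x ⊗ₜ y)) := by
  obtain ⟨g, hg⟩ := G.exists_slice_T₁_section
  refine ⟨G.slice ∘ₗ G.T₄.toLinearMap ∘ₗ g, fun x y => ?_⟩
  conv_rhs => rw [← hg x]
  exact (G.sliceL_counit_T₁_symm_slice_T₁ _ _).symm

/-- The antipode `S`, determined by `S(x) y = (ε ⊗ ι)(T₁⁻¹(x ⊗ y))`. -/
def antipode : A →ₗ[ℂ] A := G.exists_antipode.choose

lemma antipode_mul_right (x y : A) :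
    G.antipode x * y = sliceL G.counit (G.T₁.symm (x ⊗ₜ y)) := G.exists_antipode.choose_spec x y

lemma antipode_slice_T₁ (t : A ⊗[ℂ] A) : G.antipode (G.slice (G.T₁ t)) = G.slice (G.T₄ t) :=
  G.mul_right_ext fun y => by rw [antipode_mul_right, sliceL_counit_T₁_symm_slice_T₁]

lemma sliceL_counit_T₁_symm_mulR₁ (y : A) (t : A ⊗[ℂ] A) :
    sliceL G.counit (G.T₁.symm (mulR₁ y t)) =
      G.antipode y * sliceL G.counit (G.T₁.symm t) := by
  obtain ⟨w, rfl⟩ := G.T₁.surjective t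
  rw [LinearEquiv.symm_apply_apply]
  induction w with
  | zero => simp
  | add s t hs ht => simp only [map_add, mul_add, hs, ht]
  | tmul m n =>
    have h : G.counit ∘ₗ LinearMap.mulLeft ℂ m = G.counit m • G.counit :=
      LinearMap.ext (G.counit_mul m)
    have sliceL_smul (t : A ⊗[ℂ] A) :
        sliceL (G.counit m • G.counit) t = G.counit m • sliceL G.counit t := by
      induction t <;> simp_all [mul_smul]
    rw [T₁_symm_mulR₁_T₁, sliceL_rTensor, h, sliceL_smul, ← antipode_mul_right, sliceL_tmul,
      mul_smul_comm]

lemma antipode_mul (x y : A) : G.antipode (x * y) = G.antipode y * G.antipode x :=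
  G.mul_right_ext fun z => by
    rw [mul_assoc, antipode_mul_right G x, ← sliceL_counit_T₁_symm_mulR₁, antipode_mul_right]
    rfl

lemma mulR₂_lTensor_antipode_T₂ (p x d : A) :
    mulR₂ d (G.antipode.lTensor A (G.T₂ (p ⊗ₜ x))) = mulL₁ p (G.T₁.symm (x ⊗ₜ d)) := by
  have h : (sliceL G.counit ∘ₗ G.T₁.symm.toLinearMap) ∘ₗ (TensorProduct.mk ℂ A A).flip d =
      LinearMap.mulRight ℂ d ∘ₗ G.antipode :=
    LinearMap.ext fun v => (G.antipode_mul_right v d).symm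
  rw [← G.rTensor_sliceR_counit_T₂, ← lTensor_sliceL_comulL, mulR₂, ← LinearMap.lTensor_comp_apply,
    ← h, LinearMap.lTensor_comp_apply, lTensor_mk_flip, ← comulL_tmul,
    ← G.T₁.apply_symm_apply (x ⊗ₜ d), comulL_T₁, ← LinearMap.lTensor_comp_apply]
  simp only [LinearMap.comp_assoc, LinearEquiv.symm_comp, LinearMap.comp_id,
    LinearEquiv.apply_symm_apply]

lemma T₁_lTensor_antipode_T₂ (t : A ⊗[ℂ] A) :
    G.T₁ (G.antipode.lTensor A (G.T₂ t)) = G.T₃ t := by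
  induction t with
  | zero => simp
  | add s t hs ht => simp only [map_add, hs, ht]
  | tmul p x =>
    refine G.mulR₂_ext fun d => ?_
    rw [← T₁_mulR₂, mulR₂_lTensor_antipode_T₂, T₁_mulL₁, LinearEquiv.apply_symm_apply,
      T₃_mulRight]

lemma mul'_lTensor_antipode_T₂ (t : A ⊗[ℂ] A) :
    LinearMap.mul' ℂ A (G.antipode.lTensor A (G.T₂ t)) = sliceR G.counit t := by
  induction t with
  | zero => simp
  | add s t hs ht => simp only [map_add, hs, ht]
  | tmul p x =>
    refine G.mul_right_ext fun d => ?_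
    rw [← mul'_mulR₂, mulR₂_lTensor_antipode_T₂, mul'_mulL₁, mul'_T₁_symm, sliceR_tmul,
      mul_smul_comm, smul_mul_assoc]

lemma antipode_bijective : Function.Bijective G.antipode := by
  obtain ⟨a, ha⟩ := G.exists_φ_eq_one
  have : Nontrivial A := ⟨a, 0, fun h => by simp [h] at ha⟩
  have h : G.antipode.lTensor A = (G.T₂.symm ≪≫ₗ G.T₃ ≪≫ₗ G.T₁.symm).toLinearMap :=
    LinearMap.ext fun t => by
      simp [← T₁_lTensor_antipode_T₂]
  rw [← Module.FaithfullyFlat.lTensor_bijective_iff_bijective ℂ A, h]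
  exact LinearEquiv.bijective _

/-- The antipode as a linear equivalence. -/
def antipodeEquiv : A ≃ₗ[ℂ] A := LinearEquiv.ofBijective G.antipode G.antipode_bijective

lemma comulL_T₁_tmul (p q d : A) : G.comulL p (G.T₁ (q ⊗ₜ d)) =
    (G.T₁.toLinearMap ∘ₗ (TensorProduct.mk ℂ A A).flip d).lTensor A (G.T₂ (p ⊗ₜ q)) := by
  rw [comulL_T₁, comulL_tmul, ← lTensor_mk_flip, LinearMap.lTensor_comp_apply]

lemma rTensor_mul'_antipode_comulL (p : A) (v : A ⊗[ℂ] A) :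
    (LinearMap.mul' ℂ A ∘ₗ G.antipode.lTensor A).rTensor A
      ((TensorProduct.assoc ℂ A A A).symm (G.comulL p v)) = p ⊗ₜ sliceL G.counit v := by
  induction v with
  | zero => simp
  | add s t hs ht => simp only [map_add, TensorProduct.tmul_add, hs, ht]
  | tmul a b =>
    rw [comulL_tmul, LinearEquiv.symm_apply_apply, LinearMap.rTensor_tmul, LinearMap.comp_apply,
      mul'_lTensor_antipode_T₂, sliceR_tmul, sliceL_tmul, TensorProduct.smul_tmul]

lemma mulL₁_rTensor_antipode_T₁ (y x d : A) :
    mulL₁ y (G.antipode.rTensor A (G.T₁ (x ⊗ₜ d))) = mulR₂ d (G.T₂.symm (y ⊗ₜ x)) := by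
  have h (t : A ⊗[ℂ] A) : (LinearMap.mul' ℂ A ∘ₗ G.antipode.lTensor A).rTensor A
      ((TensorProduct.assoc ℂ A A A).symm
        ((G.T₁.toLinearMap ∘ₗ (TensorProduct.mk ℂ A A).flip d).lTensor A (G.T₂ t))) =
      mulR₂ d t := by
    induction t with
    | zero => simp
    | add s t hs ht => simp only [map_add, hs, ht]
    | tmul p q =>
      rw [← comulL_T₁_tmul, rTensor_mul'_antipode_comulL, sliceL_counit_T₁]
      rfl
  rw [← h, LinearEquiv.apply_symm_apply, LinearMap.lTensor_tmul]
  change _ = LinearMap.rTensor A _ ((TensorProduct.assoc ℂ A A A).symm (y ⊗ₜ G.T₁ (x ⊗ₜ d)))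
  generalize G.T₁ (x ⊗ₜ d) = v
  induction v <;> simp_all [TensorProduct.tmul_add]

lemma T₂_rTensor_antipode_T₁ (t : A ⊗[ℂ] A) :
    G.T₂ (G.antipode.rTensor A (G.T₁ t)) = G.T₄ t := by
  induction t with
  | zero => simp
  | add s t hs ht => simp only [map_add, hs, ht]
  | tmul x d =>
    refine G.mulL₁_ext fun y => ?_
    rw [← T₂_mulL₁, mulL₁_rTensor_antipode_T₁, T₂_mulR₂, LinearEquiv.apply_symm_apply, mulL₁_T₄]

lemma rTensor_antipode_mulR₁ (q : A) (t : A ⊗[ℂ] A) :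
    G.antipode.rTensor A (mulR₁ q t) = mulL₁ (G.antipode q) (G.antipode.rTensor A t) := by
  induction t <;> simp_all [antipode_mul]

lemma rTensor_antipode_mulR₂ (d : A) (t : A ⊗[ℂ] A) :
    G.antipode.rTensor A (mulR₂ d t) = mulR₂ d (G.antipode.rTensor A t) := by
  induction t <;> simp_all

lemma T₂_rTensor_antipode_T₃ (p q : A) :
    G.T₂ (G.antipode.rTensor A (G.T₃ (p ⊗ₜ q))) = G.antipode q ⊗ₜ p := by
  refine G.rmul_ext fun y => ?_
  rw [← T₂_mulR₂, ← rTensor_antipode_mulR₂, T₃_mulRight, ← T₁_mulRight, rTensor_antipode_mulR₁,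
    T₂_mulL₁, T₂_rTensor_antipode_T₁, mulL₁_T₄]

lemma T₂_antipode_tmul (y c : A) : G.T₂ (G.antipode y ⊗ₜ c) =
    TensorProduct.comm ℂ A A (G.antipode.lTensor A (G.T₃.symm (y ⊗ₜ c))) := by
  have h (t : A ⊗[ℂ] A) : G.T₂ (G.antipode.rTensor A (G.T₃ t)) =
      TensorProduct.comm ℂ A A (G.antipode.lTensor A t) := by
    induction t with
    | zero => simp
    | add s t hs ht => simp only [map_add, hs, ht]
    | tmul p q => exact G.T₂_rTensor_antipode_T₃ p q
  rw [← h, LinearEquiv.apply_symm_apply, LinearMap.rTensor_tmul]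

lemma comulL_lTensor (z : A) (f : A →ₗ[ℂ] A) (t : A ⊗[ℂ] A) :
    G.comulL z (f.lTensor A t) = (f.lTensor A).lTensor A (G.comulL z t) := by
  induction t with
  | zero => simp
  | add s t hs ht => simp only [map_add, hs, ht]
  | tmul a b =>
    rw [LinearMap.lTensor_tmul, comulL_tmul, comulL_tmul, ← lTensor_mk_flip, ← lTensor_mk_flip,
      ← LinearMap.lTensor_comp_apply]
    rfl

lemma comulL_T₄ (z a c : A) : G.comulL z (G.T₄ (a ⊗ₜ c)) =
    (G.T₄.toLinearMap ∘ₗ TensorProduct.mk ℂ A A a).lTensor A (G.T₂ (z ⊗ₜ c)) := by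
  refine sub_eq_zero.1 <| lTensor_jointly_injective (mulR₂ : A → _)
    (fun x hx => G.mulR₂_ext (t := 0) fun c => by rw [hx, map_zero]) _ fun d => ?_
  have h : mulR₂ d ∘ₗ G.T₄.toLinearMap ∘ₗ TensorProduct.mk ℂ A A a =
      mulL₂ a ∘ₗ G.T₁.toLinearMap ∘ₗ (TensorProduct.mk ℂ A A).flip d :=
    LinearMap.ext fun x => G.mulR₂_T₄ a x d
  rw [map_sub, sub_eq_zero, ← comulL_lTensor, mulR₂_T₄, comulL_lTensor, comulL_T₁_tmul,
    ← LinearMap.lTensor_comp_apply, ← LinearMap.lTensor_comp_apply, h]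

lemma T₂_slice_eq_comulL (z : A) (v : A ⊗[ℂ] A) :
    G.T₂ (z ⊗ₜ G.slice v) = G.slice.lTensor A (G.comulL z v) := by
  rw [T₂_slice]
  congr 1
  induction v <;> simp_all [comulL, TensorProduct.tmul_add]

lemma T₂_slice_T₄ (z a c : A) : G.T₂ (z ⊗ₜ G.slice (G.T₄ (a ⊗ₜ c))) =
    (G.slice ∘ₗ G.T₄.toLinearMap ∘ₗ TensorProduct.mk ℂ A A a).lTensor A (G.T₂ (z ⊗ₜ c)) := by
  rw [T₂_slice_eq_comulL, comulL_T₄, ← LinearMap.lTensor_comp_apply]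

lemma T₂_map_antipode (t : A ⊗[ℂ] A) :
    G.T₂ (TensorProduct.map G.antipode G.antipode (TensorProduct.comm ℂ A A t)) =
      TensorProduct.map G.antipode G.antipode (TensorProduct.comm ℂ A A (G.T₁ t)) := by
  have key (a c y : A) : G.T₂ (G.antipode y ⊗ₜ G.antipode (G.slice (G.T₁ (a ⊗ₜ c)))) =
      TensorProduct.map G.antipode G.antipode
        (TensorProduct.comm ℂ A A (G.T₁ (G.slice (G.T₁ (a ⊗ₜ c)) ⊗ₜ y))) := by
    rw [antipode_slice_T₁, T₂_slice_T₄, T₂_antipode_tmul]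
    change _ = TensorProduct.map _ _ (TensorProduct.comm ℂ A A (G.iter a (y ⊗ₜ c)))
    rw [← G.T₃.apply_symm_apply (y ⊗ₜ c), iter_T₃, LinearEquiv.apply_symm_apply]
    generalize G.T₃.symm (y ⊗ₜ c) = s
    induction s <;> simp_all [antipode_slice_T₁, sliceAct_apply]
  induction t with
  | zero => simp
  | add s t hs ht => simp only [map_add, hs, ht]
  | tmul x y =>
    obtain ⟨g, hg⟩ := G.exists_slice_T₁_section
    rw [← hg x]
    induction g x with
    | zero => simp
    | add s t hs ht => simp_all only [map_add, TensorProduct.add_tmul]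
    | tmul a c => exact key a c y

/-! ### The right integral -/

/-- The right integral `φ ∘ S`. -/
def ψ : Module.Dual ℂ A := G.φ ∘ₗ G.antipode

lemma slice_T₂ (t : A ⊗[ℂ] A) : G.slice (G.T₂ t) = G.slice t := by
  induction t with
  | zero => simp
  | add s t hs ht => simp only [map_add, hs, ht]
  | tmul z a =>
    refine G.mul_right_ext fun c => ?_
    rw [slice_mul, mulR₁_T₂, ← mul_slice, slice_T₃, slice_tmul, mul_smul_comm, smul_mul_assoc]

lemma sliceL_ψ_T₁ (t : A ⊗[ℂ] A) : sliceL G.ψ (G.T₁ t) = sliceL G.ψ t := by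
  have h (t : A ⊗[ℂ] A) : G.antipode (sliceL G.ψ t) =
      G.slice (TensorProduct.map G.antipode G.antipode (TensorProduct.comm ℂ A A t)) := by
    induction t <;> simp_all [ψ]
  apply G.antipode_bijective.injective
  rw [h, ← T₂_map_antipode, slice_T₂, h]

lemma sliceL_ψ_T₄ (y x : A) : sliceL G.ψ (G.T₄ (y ⊗ₜ x)) = G.ψ x • y :=
  G.mul_right_ext fun c => by
    rw [← sliceL_mulR₂, mulR₂_T₄, sliceL_mulL₂, sliceL_ψ_T₁, sliceL_tmul, mul_smul_comm,
      smul_mul_assoc]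

lemma antipode_sliceL_ψ_T₂ (t : A ⊗[ℂ] A) :
    G.antipode (sliceL G.ψ (G.T₂ t)) = sliceL G.ψ (G.T₃ t) := by
  rw [← T₁_lTensor_antipode_T₂, sliceL_ψ_T₁, sliceL_lTensor]

/-- `p ⊗ q ↦ (ι ⊗ φ ∘ S⁻¹)((1 ⊗ S(q))Δ(p))`; paired with `kmsRight`, it converts a functional
`ψ(s · )` into one of the form `φ( · c)`. -/
def kmsLeft : A ⊗[ℂ] A →ₗ[ℂ] A :=
  sliceR (G.φ ∘ₗ G.antipodeEquiv.symm.toLinearMap) ∘ₗ G.T₄.toLinearMap ∘ₗ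
    (TensorProduct.comm ℂ A A).toLinearMap ∘ₗ G.antipode.lTensor A

/-- `p ⊗ q ↦ (φ ⊗ ι)(Δ(q)(S(p) ⊗ 1))`, the element `c` that belongs to `s = kmsLeft (p ⊗ q)`. -/
def kmsRight : A ⊗[ℂ] A →ₗ[ℂ] A :=
  sliceL G.φ ∘ₗ G.T₃.toLinearMap ∘ₗ (TensorProduct.comm ℂ A A).toLinearMap ∘ₗ
    G.antipode.rTensor A

lemma kmsLeft_surjective : Function.Surjective G.kmsLeft := by
  refine (sliceR_surjective fun h => G.φ_ne_zero (LinearMap.ext fun x => ?_)).comp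
    (G.T₄.surjective.comp ((TensorProduct.comm ℂ A A).surjective.comp
      (LinearMap.lTensor_surjective A G.antipode_bijective.surjective)))
  simpa using LinearMap.congr_fun h (G.antipodeEquiv x)

lemma kmsRight_surjective : Function.Surjective G.kmsRight :=
  (sliceL_surjective G.φ_ne_zero).comp (G.T₃.surjective.comp
    ((TensorProduct.comm ℂ A A).surjective.comp
      (LinearMap.rTensor_surjective A G.antipode_bijective.surjective)))

-- Both sides equal `(ψ ⊗ φ)((p ⊗ 1)Δ(x)(1 ⊗ q))`.
lemma ψ_kmsLeft_mul (t : A ⊗[ℂ] A) (x : A) :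
    G.ψ (G.kmsLeft t * x) = G.φ (x * G.kmsRight t) := by
  induction t with
  | zero => simp
  | add s t hs ht => simp only [map_add, add_mul, mul_add, hs, ht]
  | tmul p q =>
    trans G.ψ (p * G.slice (G.T₁ (x ⊗ₜ q)))
    · have hS : G.antipode (sliceL G.ψ (G.T₂ (p ⊗ₜ x)) * q) =
          sliceL G.ψ (mulR₁ x (G.T₄ (G.antipode q ⊗ₜ p))) := by
        rw [antipode_mul, antipode_sliceL_ψ_T₂, ← sliceL_mulL₂, mulR₁_T₄]
      calc G.ψ (G.kmsLeft (p ⊗ₜ q) * x)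
        _ = G.φ (G.antipodeEquiv.symm
              (sliceL G.ψ (mulR₁ x (G.T₄ (G.antipode q ⊗ₜ p))))) := by
          rw [← LinearEquiv.coe_coe, ← LinearMap.comp_apply G.φ, ← apply_sliceR, sliceR_mulR₁]
          rfl
        _ = G.φ (sliceL G.ψ (mulR₂ q (G.T₂ (p ⊗ₜ x)))) := by
          rw [← hS, sliceL_mulR₂]
          exact congrArg G.φ (G.antipodeEquiv.symm_apply_apply _)
        _ = G.ψ (p * G.slice (G.T₁ (x ⊗ₜ q))) := by
          rw [T₂_T₁, ← apply_sliceR, ← slice_eq_sliceR, mul_slice]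
    · calc G.ψ (p * G.slice (G.T₁ (x ⊗ₜ q)))
        _ = G.φ (G.slice (mulR₁ (G.antipode p) (G.T₄ (x ⊗ₜ q)))) := by
          rw [← slice_mul, ← antipode_slice_T₁, ← antipode_mul]
          rfl
        _ = G.φ (x * G.kmsRight (p ⊗ₜ q)) := by
          rw [mulR₁_T₄, slice_eq_sliceR, apply_sliceR, sliceL_mulL₂]
          rfl

/-- The functional `ψ(s · )` as an element of `B`. -/
def toDualψ : A →ₗ[ℂ] G.Dual :=
  LinearMap.codRestrict (LinearMap.range G.dualMap) ((LinearMap.mul ℂ A).compr₂ G.ψ) fun s => by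
    obtain ⟨t, rfl⟩ := G.kmsLeft_surjective s
    exact ⟨G.kmsRight t, LinearMap.ext fun a => (G.ψ_kmsLeft_mul t a).symm⟩

@[simp] lemma eval_toDualψ (s a : A) : G.eval (G.toDualψ s) a = G.ψ (s * a) := rfl

lemma toDualψ_surjective : Function.Surjective G.toDualψ := by
  rintro ⟨_, c, rfl⟩
  obtain ⟨t, rfl⟩ := G.kmsRight_surjective c
  exact ⟨G.kmsLeft t, Subtype.ext (LinearMap.ext fun a => G.ψ_kmsLeft_mul t a)⟩

end AlgebraicQuantumGroup

section Span

variable {R X Y Z W : Type*} [CommRing R] [AddCommGroup X] [Module R X] [AddCommGroup Y]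
  [Module R Y] [AddCommGroup Z] [Module R Z] [AddCommGroup W] [Module R W]
  {f : X →ₗ[R] Y →ₗ[R] Z}

lemma map₂_eq_top_of_forall (h : ∀ S : Submodule R Z, (∀ x y, f x y ∈ S) → S = ⊤) :
    Submodule.map₂ f ⊤ ⊤ = ⊤ :=
  h _ fun _ _ => Submodule.apply_mem_map₂ f Submodule.mem_top Submodule.mem_top

lemma eq_top_of_map₂_eq_top (hf : Submodule.map₂ f ⊤ ⊤ = ⊤) {S : Submodule R Z}
    (h : ∀ x y, f x y ∈ S) : S = ⊤ :=
  top_le_iff.1 (hf ▸ Submodule.map₂_le.2 fun x _ y _ => h x y)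

lemma ext_of_map₂_eq_top (hf : Submodule.map₂ f ⊤ ⊤ = ⊤) {k l : Z →ₗ[R] W}
    (h : ∀ x y, k (f x y) = l (f x y)) : k = l :=
  LinearMap.eqLocus_eq_top.1 (eq_top_of_map₂_eq_top hf h)

lemma map₂_compr₂_mk_eq_top {k : X ⊗[R] Y →ₗ[R] Z} (hk : Function.Surjective k) :
    Submodule.map₂ ((TensorProduct.mk R X Y).compr₂ k) ⊤ ⊤ = ⊤ := by
  rw [← Submodule.map_map₂, TensorProduct.map₂_mk_top_top_eq_top, Submodule.map_top,
    LinearMap.range_eq_top.2 hk]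

lemma apply_mem_of_map₂_eq_top (hf : Submodule.map₂ f ⊤ ⊤ = ⊤) (k : Z →ₗ[R] W)
    {S : Submodule R W} (h : ∀ x y, k (f x y) ∈ S) (z : Z) : k z ∈ S :=
  (eq_top_of_map₂_eq_top hf (S := S.comap k) h).ge Submodule.mem_top

end Span

section MulSpan

variable {R C D : Type*} [CommRing R] [AddCommGroup C] [Module R C] [NonUnitalRing D] [Module R D]
  {ρ : C →ₗ[R] Module.End R D}

lemma eq_zero_of_mul_span [SMulCommClass R D D] (hD : IsNondegenerateProduct D)
    (hspan : Submodule.map₂ ρ ⊤ ⊤ = ⊤) {d : D} (h : ∀ c d', d * ρ c d' = 0) : d = 0 :=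
  hD.1 d (LinearMap.congr_fun (ext_of_map₂_eq_top hspan h : LinearMap.mulLeft R d = 0))

lemma eq_zero_of_span_mul [IsScalarTower R D D] (hD : IsNondegenerateProduct D)
    (hspan : Submodule.map₂ ρ ⊤ ⊤ = ⊤) {d : D} (h : ∀ c d', ρ c d' * d = 0) : d = 0 :=
  hD.2 d (LinearMap.congr_fun (ext_of_map₂_eq_top hspan h : LinearMap.mulRight R d = 0))

end MulSpan

namespace AlgebraicQuantumGroup

variable {A : Type*} [NonUnitalRing A] [Module ℂ A] [IsScalarTower ℂ A A] [SMulCommClass ℂ A A]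
variable (G : AlgebraicQuantumGroup A)

open Multiplier

/-! ### Faithfulness of the integral -/

lemma counit_ne_zero : G.counit ≠ 0 := by
  intro h
  obtain ⟨x, hx⟩ := G.exists_φ_eq_one
  have hx₀ : x = 0 := G.nondegenerate.1 x fun y => by
    rw [← LinearMap.mul'_apply (R := ℂ), ← sliceL_counit_T₁, h]
    simp [sliceL]
  simp [hx₀] at hx

lemma map₂_mul_eq_top (G : AlgebraicQuantumGroup A) :
    Submodule.map₂ (LinearMap.mul ℂ A) ⊤ ⊤ = ⊤ := by
  refine map₂_eq_top_of_forall fun S hS => eq_top_iff.2 fun x _ => ?_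
  obtain ⟨t, rfl⟩ := (sliceL_surjective G.counit_ne_zero).comp G.T₁.surjective x
  rw [Function.comp_apply, sliceL_counit_T₁]
  induction t with
  | zero => simp
  | add s t hs ht => rw [map_add]; exact S.add_mem (hs trivial) (ht trivial)
  | tmul a b => exact hS a b

lemma mul_act (b : G.Dual) (x y : A) : y * G.act b x = sliceR (G.eval b) (G.T₂ (y ⊗ₜ x)) := by
  obtain ⟨c, rfl⟩ := G.toDual_surjective b
  rw [act_toDual, slice_eq_sliceR, ← sliceR_mulL₁]
  have h := congrArg (sliceR G.φ) (G.T₂_T₁ y x c)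
  rw [sliceR_lTensor] at h
  exact h.symm

section Annihilator

variable {G} {a : A} (ha : ∀ b, G.eval b a = 0)
include ha

lemma act_eq_zero_of_eval (b : G.Dual) : G.act b a = 0 := by
  obtain ⟨c, rfl⟩ := G.toDual_surjective b
  refine G.antipode_bijective.1 (G.mul_left_ext fun z => ?_)
  have hφ : G.φ ∘ₗ LinearMap.mulLeft ℂ a = 0 := LinearMap.ext fun x => ha (G.toDual x)
  have hT : mulL₁ z (G.T₄ (a ⊗ₜ c)) = mulL₂ a (G.T₂ (z ⊗ₜ c)) := by
    apply of_injective G.nondegenerate₂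
    rw [G.of_mulL₁, G.of_mulL₂, ← T₄_spec, ← T₂_spec, ← mul_assoc, ← mul_assoc, tmul_mul_tmul,
      tmul_mul_tmul, one_mul, mul_one, mul_one, one_mul]
  rw [act_toDual, antipode_slice_T₁, slice_eq_sliceR, ← sliceR_mulL₁, hT, mulL₂, sliceR_lTensor,
    hφ]
  simp [sliceR]

lemma eval_mul_right_eq_zero (y : A) (b : G.Dual) : G.eval b (a * y) = 0 := by
  obtain ⟨c, rfl⟩ := G.toDual_surjective b
  rw [eval_toDual, mul_assoc]
  exact ha (G.toDual (y * c))

lemma sliceL_eval_T₁_symm_eq_zero (y : A) (b : G.Dual) :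
    sliceL (G.eval b) (G.T₁.symm (a ⊗ₜ y)) = 0 := by
  obtain ⟨s, rfl⟩ := G.toDualψ_surjective b
  have hψ : G.ψ ∘ₗ LinearMap.mulRight ℂ a = 0 := LinearMap.ext fun x => ha (G.toDualψ x)
  calc sliceL (G.ψ ∘ₗ LinearMap.mulLeft ℂ s) (G.T₁.symm (a ⊗ₜ y))
      = sliceL G.ψ (G.T₁ (mulL₁ s (G.T₁.symm (a ⊗ₜ y)))) := by
        rw [sliceL_ψ_T₁, mulL₁, sliceL_rTensor]
    _ = sliceL G.ψ (mulR₁ a (G.T₁ (s ⊗ₜ y))) := by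
        rw [T₁_mulL₁, LinearEquiv.apply_symm_apply, ← T₁_mulRight]
    _ = 0 := by
        rw [mulR₁, sliceL_rTensor, hψ]
        simp [sliceL]

lemma counit_eq_zero_of_eval : G.counit a = 0 := by
  by_contra hε
  have hz : ∀ y b, G.eval b y = 0 := by
    intro y b
    have h := map_eq_zero_of_sliceL_eq_zero G.eval (G.eval b ∘ₗ LinearMap.mul' ℂ A)
      (fun x hx y => eval_mul_right_eq_zero hx y b) (sliceL_eval_T₁_symm_eq_zero ha y)
    rw [LinearMap.comp_apply, mul'_T₁_symm, map_smul] at h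
    exact (smul_eq_zero.1 h).resolve_left hε
  exact G.φ_ne_zero (ext_of_map₂_eq_top G.map₂_mul_eq_top fun x y => hz x (G.toDual y))

lemma eq_zero_of_eval : a = 0 := by
  refine G.nondegenerate.2 a fun y => ?_
  rw [← G.sliceR_counit_T₂, ← Module.forall_dual_apply_eq_zero_iff ℂ]
  intro ω
  rw [apply_sliceR]
  refine counit_eq_zero_of_eval fun b => ?_
  rw [← apply_sliceR, ← mul_act, act_eq_zero_of_eval ha, mul_zero, map_zero]

end Annihilator

/-! ### The dual -/

lemma dual_eq_zero_of_eval {b : G.Dual} (hb : ∀ a, G.eval b a = 0) : b = 0 :=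
  G.eval_injective (LinearMap.ext fun a => (hb a).trans (by simp))

lemma map₂_act_eq_top : Submodule.map₂ G.act ⊤ ⊤ = ⊤ :=
  map₂_eq_top_of_forall fun _ hS =>
    eq_top_of_map₂_eq_top (map₂_compr₂_mk_eq_top
      (k := G.slice ∘ₗ G.T₁.toLinearMap) (G.slice_surjective.comp G.T₁.surjective))
        fun x c => G.act_toDual c x ▸ hS (G.toDual c) x

lemma counit_act (b : G.Dual) (x : A) : G.counit (G.act b x) = G.eval b x := by
  obtain ⟨c, rfl⟩ := G.toDual_surjective b
  rw [act_toDual, counit_slice_T₁, eval_toDual]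

lemma eq_zero_of_act {x : A} (hx : ∀ b, G.act b x = 0) : x = 0 :=
  eq_zero_of_eval fun b => by rw [← counit_act, hx, map_zero]

lemma dual_eq_zero_of_act {b : G.Dual} (hb : ∀ x, G.act b x = 0) : b = 0 :=
  G.dual_eq_zero_of_eval fun x => by rw [← counit_act, hb, map_zero]

lemma dual_nondegenerate : IsNondegenerateProduct G.Dual := by
  refine ⟨fun b hb => G.eval_injective ?_, fun b hb => ?_⟩
  · refine ext_of_map₂_eq_top G.map₂_act_eq_top fun c x => ?_
    simp [← eval_mul, hb]
  · refine G.dual_eq_zero_of_act fun x => eq_zero_of_eval (G := G) fun c => ?_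
    simp [← eval_mul, hb]

lemma map₂_dual_mul_eq_top : Submodule.map₂ (LinearMap.mul ℂ G.Dual) ⊤ ⊤ = ⊤ :=
  map₂_eq_top_of_forall fun _ hS =>
    eq_top_of_map₂_eq_top (map₂_compr₂_mk_eq_top
      (k := G.toDual ∘ₗ G.slice ∘ₗ G.T₃.symm.toLinearMap)
        (G.toDual_surjective.comp (G.slice_surjective.comp G.T₃.symm.surjective)))
          fun c d => G.toDual_mul c d ▸ hS (G.toDual c) (G.toDual d)

/-- The right action of `A` on its dual: `⟨x, b ◁ a⟩ = ⟨a x, b⟩`. -/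
def actDualR : A →ₗ[ℂ] Module.End ℂ G.Dual :=
  LinearMap.mk₂ ℂ
    (fun a b => ⟨G.eval b ∘ₗ LinearMap.mulLeft ℂ a, by
      obtain ⟨s, rfl⟩ := G.toDualψ_surjective b
      have h : G.eval (G.toDualψ s) ∘ₗ LinearMap.mulLeft ℂ a = G.eval (G.toDualψ (s * a)) :=
        LinearMap.ext fun x => by simp [mul_assoc]
      exact h ▸ (G.toDualψ (s * a)).2⟩)
    (fun a a' b => G.eval_injective (LinearMap.ext fun x =>
      (congrArg (G.eval b) (add_mul a a' x)).trans (map_add _ _ _)))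
    (fun r a b => G.eval_injective (LinearMap.ext fun x =>
      (congrArg (G.eval b) (smul_mul_assoc r a x)).trans (map_smul _ _ _)))
    (fun _ _ _ => rfl) (fun _ _ _ => rfl)

lemma eval_actDualR (a x : A) (b : G.Dual) : G.eval (G.actDualR a b) x = G.eval b (a * x) := rfl

lemma actDualR_toDualψ (a s : A) : G.actDualR a (G.toDualψ s) = G.toDualψ (s * a) :=
  G.eval_injective (LinearMap.ext fun x => by simp [eval_actDualR, mul_assoc])

lemma map₂_actDualR_eq_top : Submodule.map₂ G.actDualR ⊤ ⊤ = ⊤ := by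
  refine map₂_eq_top_of_forall fun S hS => eq_top_iff.2 fun b _ => ?_
  obtain ⟨s, rfl⟩ := G.toDualψ_surjective b
  exact apply_mem_of_map₂_eq_top G.map₂_mul_eq_top G.toDualψ
    (fun s a => (congrArg (· ∈ S) (G.actDualR_toDualψ a s)).mp (hS a (G.toDualψ s))) s

/-! ### The duality as a multiplier -/

/-- Evaluation of the first leg of an element of `B ⊗ A`. -/
def evalL (z : A) : G.Dual ⊗[ℂ] A →ₗ[ℂ] A := sliceL (G.eval.flip z)

@[simp] lemma evalL_tmul (z : A) (b : G.Dual) (a : A) : G.evalL z (b ⊗ₜ a) = G.eval b z • a := by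
  simp [evalL]

lemma evalL_ext {s t : G.Dual ⊗[ℂ] A} (h : ∀ z, G.evalL z s = G.evalL z t) : s = t := by
  refine sub_eq_zero.1 (map_eq_zero_of_sliceL_eq_zero G.eval.flip LinearMap.id
    (fun b hb a => ?_) fun z => (map_sub (G.evalL z) s t).trans (sub_eq_zero.2 (h z)))
  simp [G.dual_eq_zero_of_eval hb]

/-- The map `b ⊗ a ↦ (b ▷ z) ⊗ a`. -/
def actL (z : A) : G.Dual ⊗[ℂ] A →ₗ[ℂ] A ⊗[ℂ] A := (G.act.flip z).rTensor A

@[simp] lemma actL_tmul (z : A) (b : G.Dual) (a : A) : G.actL z (b ⊗ₜ a) = G.act b z ⊗ₜ a := rfl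

lemma sliceL_counit_actL (z : A) (t : G.Dual ⊗[ℂ] A) :
    sliceL G.counit (G.actL z t) = G.evalL z t := by
  induction t <;> simp_all [counit_act]

lemma evalL_tmul_mul (z : A) (b : G.Dual) (a : A) (t : G.Dual ⊗[ℂ] A) :
    G.evalL z ((b ⊗ₜ a) * t) = a * sliceL (G.eval b) (G.actL z t) := by
  induction t <;> simp_all [mul_add, mul_smul_comm]

lemma evalL_mul_tmul (z : A) (b : G.Dual) (a : A) (t : G.Dual ⊗[ℂ] A) :
    G.evalL z (t * (b ⊗ₜ a)) = G.evalL (G.act b z) t * a := by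
  induction t <;> simp_all [add_mul, smul_mul_assoc]

lemma exists_dualityL : ∃ L : G.Dual ⊗[ℂ] A →ₗ[ℂ] G.Dual ⊗[ℂ] A, ∀ z t,
    G.actL z (L t) = G.T₁ (G.actL z t) := by
  obtain ⟨g, hg⟩ := G.toDual.exists_rightInverse_of_surjective
    (LinearMap.range_eq_top.2 G.toDual_surjective)
  refine ⟨G.toDual.rTensor A ∘ₗ G.T₃.symm.toLinearMap ∘ₗ
    (TensorProduct.comm ℂ A A).toLinearMap ∘ₗ g.rTensor A, fun z t => ?_⟩
  have hiter (s : A ⊗[ℂ] A) : G.actL z (G.toDual.rTensor A s) =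
      (G.sliceAct.flip z).rTensor A s := by
    induction s <;> simp_all [act_toDual']
  induction t with
  | zero => simp
  | add s t hs ht => simp only [map_add, hs, ht]
  | tmul b a =>
    have hb : G.toDual (g b) = b := congrArg (· b) hg
    have h := G.iter_T₃ z (G.T₃.symm (a ⊗ₜ g b))
    rw [LinearEquiv.apply_symm_apply, iter_tmul, ← act_toDual', hb, ← hiter] at h
    exact h.symm

lemma exists_dualityR : ∃ R : G.Dual ⊗[ℂ] A →ₗ[ℂ] G.Dual ⊗[ℂ] A, ∀ z b a,
    G.evalL z (R (b ⊗ₜ a)) = sliceL (G.eval b) (G.T₄ (a ⊗ₜ z)) := by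
  obtain ⟨g, hg⟩ := G.toDualψ.exists_rightInverse_of_surjective
    (LinearMap.range_eq_top.2 G.toDualψ_surjective)
  refine ⟨G.toDualψ.rTensor A ∘ₗ (TensorProduct.comm ℂ A A).toLinearMap ∘ₗ
    G.T₄.symm.toLinearMap ∘ₗ g.rTensor A, fun z b a => ?_⟩
  have hT (t : A ⊗[ℂ] A) : G.evalL z (G.toDualψ.rTensor A (TensorProduct.comm ℂ A A t)) =
      sliceL G.ψ ((G.Δ z).rmul (G.T₄ t)) := by
    induction t with
    | zero => simp
    | add s t hs ht => simp only [map_add, hs, ht]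
    | tmul p q => rw [← T₄_mulR₂]; simp [sliceL_ψ_T₄]
  have hb : G.ψ ∘ₗ LinearMap.mulLeft ℂ (g b) = G.eval b :=
    congrArg G.eval (congrArg (· b) hg : G.toDualψ (g b) = b)
  calc G.evalL z (G.toDualψ.rTensor A (TensorProduct.comm ℂ A A (G.T₄.symm (g b ⊗ₜ a))))
      = sliceL G.ψ (mulL₁ (g b) (G.T₄ (a ⊗ₜ z))) := by
        rw [hT, LinearEquiv.apply_symm_apply, mulL₁_T₄]
    _ = sliceL (G.eval b) (G.T₄ (a ⊗ₜ z)) := by rw [mulL₁, sliceL_rTensor, hb]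

/-- The duality `V`, as a multiplier of `B ⊗ A`. -/
def duality : Multiplier (G.Dual ⊗[ℂ] A) :=
  Multiplier.mk' G.exists_dualityL.choose G.exists_dualityR.choose fun s t => by
    have hL := G.exists_dualityL.choose_spec
    have hR := G.exists_dualityR.choose_spec
    induction s with
    | zero => simp
    | add u v hu hv => simp only [map_add, add_mul, hu, hv]
    | tmul b a =>
      induction t with
      | zero => simp
      | add u v hu hv => simp only [map_add, mul_add, hu, hv]
      | tmul b' a' =>
        refine G.evalL_ext fun z => ?_
        rw [evalL_tmul_mul, hL, evalL_mul_tmul, hR, ← sliceL_mulL₂, ← sliceL_mulR₂, mulR₂_T₄,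
          actL_tmul]

lemma actL_duality_lmul (z : A) (t : G.Dual ⊗[ℂ] A) :
    G.actL z (G.duality.lmul t) = G.T₁ (G.actL z t) := G.exists_dualityL.choose_spec z t

lemma pairing₂_tmul (t : G.Dual ⊗[ℂ] A) (x : A) (b : G.Dual) :
    G.pairing₂ t (x ⊗ₜ b) = G.eval b (G.evalL x t) := by
  induction t with
  | zero => simp
  | add s t hs ht => simp only [map_add, LinearMap.add_apply, hs, ht]
  | tmul b' a => rw [evalL_tmul, map_smul]; rfl

lemma isDuality_iff (V : Multiplier (G.Dual ⊗[ℂ] A)) :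
    G.IsDuality V ↔ ∀ z b a, G.evalL z (V.lmul (b ⊗ₜ a)) = G.act b z * a := by
  have hpair (z b a) (b' : G.Dual) : G.pairing (G.actPairing (b ⊗ₜ a) (z ⊗ₜ b')) =
      G.eval b' (G.act b z * a) := rfl
  refine ⟨fun h z b a => sub_eq_zero.1 (eq_zero_of_eval (G := G) fun b' => ?_), fun h c d => ?_⟩
  · have := h (b ⊗ₜ a) (z ⊗ₜ b')
    rw [hpair, pairing₂_tmul] at this
    rw [map_sub, this, sub_self]
  · induction c with
    | zero => simp
    | add s t hs ht => simp only [map_add, LinearMap.add_apply, hs, ht]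
    | tmul b a =>
      induction d with
      | zero => simp
      | add s t hs ht => simp only [map_add, hs, ht]
      | tmul z b' => rw [hpair, pairing₂_tmul, h]

lemma isDuality_duality : G.IsDuality G.duality :=
  G.isDuality_iff _ |>.2 fun z b a => by
    rw [← sliceL_counit_actL, actL_duality_lmul, sliceL_counit_T₁, actL_tmul,
      LinearMap.mul'_apply]

lemma nondegenerate_dual_tensor : IsNondegenerateProduct (G.Dual ⊗[ℂ] A) :=
  G.dual_nondegenerate.tensor G.nondegenerate

end AlgebraicQuantumGroup

lemma Multiplier.ext_lmul {D : Type*} [NonUnitalRing D] [Module ℂ D] [IsScalarTower ℂ D D]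
    [SMulCommClass ℂ D D] (hD : IsNondegenerateProduct D) {m n : Multiplier D}
    (h : m.lmul = n.lmul) : m = n := by
  refine Multiplier.ext' h (LinearMap.ext fun a => sub_eq_zero.1 (hD.1 _ fun b => ?_))
  rw [sub_mul, ← compat, ← compat, h, sub_self]

namespace AlgebraicQuantumGroup

variable {A : Type*} [NonUnitalRing A] [Module ℂ A] [IsScalarTower ℂ A A] [SMulCommClass ℂ A A]
variable (G : AlgebraicQuantumGroup A)

lemma IsDuality.eq_duality {V : Multiplier (G.Dual ⊗[ℂ] A)} (hV : G.IsDuality V) :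
    V = G.duality :=
  Multiplier.ext_lmul G.nondegenerate_dual_tensor <| TensorProduct.ext' fun b a =>
    G.evalL_ext fun z => by
      rw [(G.isDuality_iff V).1 hV, (G.isDuality_iff _).1 G.isDuality_duality]

lemma existsUnique_isDuality : ∃! V : Multiplier (G.Dual ⊗[ℂ] A), G.IsDuality V :=
  ⟨G.duality, G.isDuality_duality, fun _ hV => hV.eq_duality⟩

end AlgebraicQuantumGroup

/-! ### Extension to multiplier algebras -/

lemma exists_lift_of_forall {K C X : Type*} [Field K] [AddCommGroup C] [Module K C]
    [AddCommGroup X] [Module K X] {ρ : C →ₗ[K] Module.End K X}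
    (hspan : Submodule.map₂ ρ ⊤ ⊤ = ⊤) (f : C →ₗ[K] C)
    (hk : ∀ t, TensorProduct.lift ρ t = 0 → TensorProduct.lift (ρ ∘ₗ f) t = 0) :
    ∃ L : Module.End K X, ∀ c x, L (ρ c x) = ρ (f c) x := by
  obtain ⟨g, hg⟩ := (TensorProduct.lift ρ).exists_rightInverse_of_surjective
    (eq_top_of_map₂_eq_top hspan fun c x => ⟨c ⊗ₜ x, rfl⟩)
  refine ⟨TensorProduct.lift (ρ ∘ₗ f) ∘ₗ g, fun c x => ?_⟩
  rw [← sub_eq_zero]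
  refine (map_sub (TensorProduct.lift (ρ ∘ₗ f)) (g (ρ c x)) (c ⊗ₜ x)).symm.trans (hk _ ?_)
  rw [map_sub, sub_eq_zero]
  exact LinearMap.congr_fun hg (ρ c x)

section Extend

variable {C X D : Type*} [NonUnitalRing C] [Module ℂ C] [IsScalarTower ℂ C C] [SMulCommClass ℂ C C]
  [AddCommGroup X] [Module ℂ X] [NonUnitalRing D] [Module ℂ D]

open Multiplier

lemma exists_end_of_lmul {ρ : C →ₗ[ℂ] Module.End ℂ X}
    (hmul : ∀ c c' x, ρ (c * c') x = ρ c (ρ c' x))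
    (hspan : Submodule.map₂ ρ ⊤ ⊤ = ⊤) (hfaith : ∀ x, (∀ c, ρ c x = 0) → x = 0)
    (m : Multiplier C) : ∃ L : Module.End ℂ X, ∀ c x, L (ρ c x) = ρ (m.lmul c) x := by
  refine exists_lift_of_forall hspan _ fun t ht => hfaith _ fun c => ?_
  have hcompat : ρ c (TensorProduct.lift (ρ ∘ₗ m.lmul) t) =
      ρ (m.rmul c) (TensorProduct.lift ρ t) := by
    clear ht
    induction t with
    | zero => simp
    | add u v hu hv => simp only [map_add, hu, hv]
    | tmul c' x => simp [← hmul, compat]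
  rw [hcompat, ht, map_zero]

lemma exists_extendsAction {ρ : C →ₗ[ℂ] Module.End ℂ X}
    (hmul : ∀ c c' x, ρ (c * c') x = ρ c (ρ c' x))
    (hspan : Submodule.map₂ ρ ⊤ ⊤ = ⊤) (hfaith : ∀ x, (∀ c, ρ c x = 0) → x = 0) :
    ∃ σ : Multiplier C →ₐ[ℂ] Module.End ℂ X, ∀ m c x, σ m (ρ c x) = ρ (m.lmul c) x := by
  choose L hL using exists_end_of_lmul hmul hspan hfaith
  refine ⟨AlgHom.ofLinearMap
    { toFun := L
      map_add' := fun m n => ext_of_map₂_eq_top hspan fun c x => by simp [hL]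
      map_smul' := fun r m => ext_of_map₂_eq_top hspan fun c x => by simp [hL] }
    (ext_of_map₂_eq_top hspan fun c x => hL 1 c x) fun m n =>
      ext_of_map₂_eq_top hspan fun c x => ?_, hL⟩
  change L (m * n) (ρ c x) = L m (L n (ρ c x))
  rw [hL, hL, hL, lmul_mul]

lemma ExtendsAction.apply (hC : IsNondegenerateProduct C) {ρ : C →ₗ[ℂ] Module.End ℂ X}
    {σ : Multiplier C →ₐ[ℂ] Module.End ℂ X} (hσ : ExtendsAction ρ σ) (m : Multiplier C) (c : C)
    (x : X) : σ m (ρ c x) = ρ (m.lmul c) x := by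
  rw [← hσ, ← hσ, ← mul_of hC, map_mul, Module.End.mul_apply]

lemma existsUnique_extendsAction (hC : IsNondegenerateProduct C) {ρ : C →ₗ[ℂ] Module.End ℂ X}
    (hmul : ∀ c c' x, ρ (c * c') x = ρ c (ρ c' x))
    (hspan : Submodule.map₂ ρ ⊤ ⊤ = ⊤) (hfaith : ∀ x, (∀ c, ρ c x = 0) → x = 0) :
    ∃! σ : Multiplier C →ₐ[ℂ] Module.End ℂ X, ExtendsAction ρ σ := by
  obtain ⟨σ, hσ⟩ := exists_extendsAction hmul hspan hfaith
  refine ⟨σ, fun c => ext_of_map₂_eq_top hspan fun c' x => ?_, fun τ hτ => AlgHom.ext fun m =>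
    ext_of_map₂_eq_top hspan fun c x => ?_⟩
  · rw [hσ, lmul_of, hmul]
  · rw [hσ, hτ.apply hC]

/-- The maps `ρ` and `ρ'` give the left and right multiplications of a homomorphism from `C` to
`M(D)` that is non-degenerate, i.e. for which the images of `C` span `D` from either side. -/
structure IsNondegenerateHom (ρ ρ' : C →ₗ[ℂ] Module.End ℂ D) : Prop where
  map_mul : ∀ c c' d, ρ (c * c') d = ρ c (ρ c' d)
  adjoint : ∀ c d d', d * ρ c d' = ρ' c d * d'
  span_left : Submodule.map₂ ρ ⊤ ⊤ = ⊤
  span_right : Submodule.map₂ ρ' ⊤ ⊤ = ⊤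

namespace IsNondegenerateHom

variable {ρ ρ' : C →ₗ[ℂ] Module.End ℂ D} (h : IsNondegenerateHom ρ ρ')

include h

lemma apply_mul_apply (m : Multiplier C) (c c' : C) (d d' : D) :
    ρ' c d * ρ (m.lmul c') d' = ρ' (m.rmul c) d * ρ c' d' := by
  rw [← h.adjoint, ← h.adjoint, ← h.map_mul, ← h.map_mul, compat]

variable [SMulCommClass ℂ D D]

lemma exists_end_of_rmul (hD : IsNondegenerateProduct D) (m : Multiplier C) :
    ∃ R : Module.End ℂ D, ∀ c d, R (ρ' c d) = ρ' (m.rmul c) d := by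
  refine exists_lift_of_forall h.span_right _ fun t ht =>
    eq_zero_of_mul_span hD h.span_left fun c d => ?_
  have hcompat : TensorProduct.lift (ρ' ∘ₗ m.rmul) t * ρ c d =
      TensorProduct.lift ρ' t * ρ (m.lmul c) d := by
    clear ht
    induction t with
    | zero => simp
    | add u v hu hv => simp only [map_add, add_mul, hu, hv]
    | tmul c' x => exact (h.apply_mul_apply m c' c x d).symm
  rw [hcompat, ht, zero_mul]

variable [IsScalarTower ℂ D D]

lemma mul_end_apply {m : Multiplier C} {L R : Module.End ℂ D}
    (hL : ∀ c d, L (ρ c d) = ρ (m.lmul c) d) (hR : ∀ c d, R (ρ' c d) = ρ' (m.rmul c) d)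
    (a b : D) : a * L b = R a * b := by
  have hρ (c d) : LinearMap.mulRight ℂ (ρ (m.lmul c) d) = LinearMap.mulRight ℂ (ρ c d) ∘ₗ R :=
    ext_of_map₂_eq_top h.span_right fun c' d' => by
      simpa [hR] using h.apply_mul_apply m c' c d' d
  have hmul : LinearMap.mulLeft ℂ a ∘ₗ L = LinearMap.mulLeft ℂ (R a) :=
    ext_of_map₂_eq_top h.span_left fun c d => by
      simpa [hL] using LinearMap.congr_fun (hρ c d) a
  exact LinearMap.congr_fun hmul b

lemma exists_extension (hD : IsNondegenerateProduct D) :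
    ∃ θ : Multiplier C →ₐ[ℂ] Multiplier D, ∀ m c d, (θ m).lmul (ρ c d) = ρ (m.lmul c) d := by
  obtain ⟨σ, hσ⟩ := exists_extendsAction h.map_mul h.span_left fun x hx =>
    eq_zero_of_span_mul hD h.span_right fun c d => by rw [← h.adjoint, hx, mul_zero]
  choose R hR using h.exists_end_of_rmul hD
  exact ⟨AlgHom.ofLinearMap
    { toFun := fun m => Multiplier.mk' (σ m) (R m) (h.mul_end_apply (hσ m) (hR m))
      map_add' := fun m n => ext_lmul hD <| LinearMap.ext fun d => by simp
      map_smul' := fun r m => ext_lmul hD <| LinearMap.ext fun d => by simp }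
    (ext_lmul hD (_root_.map_one σ)) (fun m n => ext_lmul hD (_root_.map_mul σ m n)), hσ⟩

end IsNondegenerateHom

variable [IsScalarTower ℂ D D] [SMulCommClass ℂ D D]

lemma ExtendsHom.lmul_apply (hC : IsNondegenerateProduct C) {ρ : C →ₗ[ℂ] Module.End ℂ D}
    {θ : Multiplier C →ₐ[ℂ] Multiplier D} (hθ : ExtendsHom ρ θ) (m : Multiplier C) (c : C)
    (d : D) : (θ m).lmul (ρ c d) = ρ (m.lmul c) d := by
  rw [← hθ, ← hθ, ← mul_of hC, map_mul, lmul_mul]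

lemma IsNondegenerateHom.existsUnique_extendsHom {ρ ρ' : C →ₗ[ℂ] Module.End ℂ D}
    (h : IsNondegenerateHom ρ ρ') (hC : IsNondegenerateProduct C)
    (hD : IsNondegenerateProduct D) :
    ∃! θ : Multiplier C →ₐ[ℂ] Multiplier D, ExtendsHom ρ θ := by
  obtain ⟨θ, hθ⟩ := h.exists_extension hD
  refine ⟨θ, fun c => ext_of_map₂_eq_top h.span_left fun c' x => ?_, fun τ hτ => AlgHom.ext fun m =>
    ext_lmul hD (ext_of_map₂_eq_top h.span_left fun c x => ?_)⟩
  · rw [hθ, lmul_of, h.map_mul]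
  · rw [hθ, hτ.lmul_apply hC]

lemma isNondegenerateHom_mul (hspan : Submodule.map₂ (LinearMap.mul ℂ C) ⊤ ⊤ = ⊤) :
    IsNondegenerateHom (LinearMap.mul ℂ C) (LinearMap.mul ℂ C).flip where
  map_mul := mul_assoc
  adjoint c d d' := (mul_assoc d c d').symm
  span_left := hspan
  span_right := map₂_eq_top_of_forall fun _ hS => eq_top_of_map₂_eq_top hspan fun x y => hS y x

end Extend

section TensorRep

variable {R C₁ C₂ X₁ X₂ : Type*} [CommRing R] [AddCommGroup C₁] [Module R C₁]
  [AddCommGroup C₂] [Module R C₂] [AddCommGroup X₁] [Module R X₁] [AddCommGroup X₂] [Module R X₂]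

/-- The exterior tensor product of two actions: `(c₁ ⊗ c₂)(x₁ ⊗ x₂) = c₁x₁ ⊗ c₂x₂`. -/
abbrev tensorRep (ρ₁ : C₁ →ₗ[R] Module.End R X₁) (ρ₂ : C₂ →ₗ[R] Module.End R X₂) :
    C₁ ⊗[R] C₂ →ₗ[R] Module.End R (X₁ ⊗[R] X₂) :=
  TensorProduct.homTensorHomMap (RingHom.id R) X₁ X₂ X₁ X₂ ∘ₗ TensorProduct.map ρ₁ ρ₂

variable {ρ₁ : C₁ →ₗ[R] Module.End R X₁} {ρ₂ : C₂ →ₗ[R] Module.End R X₂}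

lemma map₂_tensorRep_eq_top (h₁ : Submodule.map₂ ρ₁ ⊤ ⊤ = ⊤) (h₂ : Submodule.map₂ ρ₂ ⊤ ⊤ = ⊤) :
    Submodule.map₂ (tensorRep ρ₁ ρ₂) ⊤ ⊤ = ⊤ :=
  map₂_eq_top_of_forall fun _ hS =>
    eq_top_of_map₂_eq_top (TensorProduct.map₂_mk_top_top_eq_top ..) fun x y =>
      apply_mem_of_map₂_eq_top h₁ ((TensorProduct.mk R X₁ X₂).flip y) (fun c₁ x =>
        apply_mem_of_map₂_eq_top h₂ (TensorProduct.mk R X₁ X₂ (ρ₁ c₁ x))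
          (fun c₂ y => hS (c₁ ⊗ₜ c₂) (x ⊗ₜ y)) y) x

lemma map₂_rTensorHom_eq_top (h₁ : Submodule.map₂ ρ₁ ⊤ ⊤ = ⊤) :
    Submodule.map₂ (LinearMap.rTensorHom X₂ ∘ₗ ρ₁) ⊤ ⊤ = ⊤ :=
  map₂_eq_top_of_forall fun _ hS =>
    eq_top_of_map₂_eq_top (TensorProduct.map₂_mk_top_top_eq_top ..) fun x y =>
      apply_mem_of_map₂_eq_top h₁ ((TensorProduct.mk R X₁ X₂).flip y)
        (fun c x => hS c (x ⊗ₜ y)) x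

lemma map₂_lTensorHom_eq_top (h₂ : Submodule.map₂ ρ₂ ⊤ ⊤ = ⊤) :
    Submodule.map₂ (LinearMap.lTensorHom X₁ ∘ₗ ρ₂) ⊤ ⊤ = ⊤ :=
  map₂_eq_top_of_forall fun _ hS =>
    eq_top_of_map₂_eq_top (TensorProduct.map₂_mk_top_top_eq_top ..) fun x y =>
      apply_mem_of_map₂_eq_top h₂ (TensorProduct.mk R X₁ X₂ x)
        (fun c y => hS c (x ⊗ₜ y)) y

end TensorRep

section TensorRepInjective

variable {C₁ C₂ X₁ X₂ : Type*} [AddCommGroup C₁] [Module ℂ C₁] [AddCommGroup C₂] [Module ℂ C₂]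
  [AddCommGroup X₁] [Module ℂ X₁] [AddCommGroup X₂] [Module ℂ X₂]
  {ρ₁ : C₁ →ₗ[ℂ] Module.End ℂ X₁} {ρ₂ : C₂ →ₗ[ℂ] Module.End ℂ X₂}

lemma tensorRep_injective (h₁ : Function.Injective ρ₁) (h₂ : Function.Injective ρ₂) :
    Function.Injective (tensorRep ρ₁ ρ₂) := by
  refine (injective_iff_map_eq_zero _).2 fun t ht =>
    rTensor_jointly_injective ρ₁.flip (fun c hc => h₁ (LinearMap.ext fun x => by simpa using hc x))
      t fun x => lTensor_jointly_injective ρ₂.flip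
        (fun c hc => h₂ (LinearMap.ext fun y => by simpa using hc y)) _ fun y => ?_
  have happly (s : C₁ ⊗[ℂ] C₂) :
      (ρ₂.flip y).lTensor X₁ ((ρ₁.flip x).rTensor C₂ s) = tensorRep ρ₁ ρ₂ s (x ⊗ₜ y) := by
    induction s <;> simp_all
  rw [happly, ht, LinearMap.zero_apply]

lemma eq_zero_of_tensorRep (h₁ : ∀ x, (∀ c, ρ₁ c x = 0) → x = 0)
    (h₂ : ∀ x, (∀ c, ρ₂ c x = 0) → x = 0) {x : X₁ ⊗[ℂ] X₂}
    (hx : ∀ c, tensorRep ρ₁ ρ₂ c x = 0) : x = 0 := by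
  refine rTensor_jointly_injective ρ₁ h₁ x fun c₁ => lTensor_jointly_injective ρ₂ h₂ _ fun c₂ => ?_
  rw [← LinearMap.comp_apply, LinearMap.lTensor_comp_rTensor]
  exact hx (c₁ ⊗ₜ c₂)

end TensorRepInjective

section TensorHom

variable {C₁ C₂ X₁ X₂ D₁ D₂ : Type*}
  [NonUnitalRing C₁] [Module ℂ C₁] [NonUnitalRing C₂] [Module ℂ C₂]
  [NonUnitalRing D₁] [Module ℂ D₁] [IsScalarTower ℂ D₁ D₁] [SMulCommClass ℂ D₁ D₁]
  [NonUnitalRing D₂] [Module ℂ D₂] [IsScalarTower ℂ D₂ D₂] [SMulCommClass ℂ D₂ D₂]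
  [AddCommGroup X₁] [Module ℂ X₁] [AddCommGroup X₂] [Module ℂ X₂]
  {ρ₁ ρ₁' : C₁ →ₗ[ℂ] Module.End ℂ D₁} {ρ₂ ρ₂' : C₂ →ₗ[ℂ] Module.End ℂ D₂}

lemma IsNondegenerateHom.rTensor (h₁ : IsNondegenerateHom ρ₁ ρ₁') :
    IsNondegenerateHom (LinearMap.rTensorHom D₂ ∘ₗ ρ₁) (LinearMap.rTensorHom D₂ ∘ₗ ρ₁') where
  map_mul c c' d := by induction d <;> simp_all [h₁.map_mul]
  adjoint c d d' := by
    induction d with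
    | zero => simp
    | add u v hu hv => simp only [map_add, add_mul, hu, hv]
    | tmul x y => induction d' <;> simp_all [mul_add, h₁.adjoint]
  span_left := map₂_rTensorHom_eq_top h₁.span_left
  span_right := map₂_rTensorHom_eq_top h₁.span_right

lemma IsNondegenerateHom.lTensor (h₂ : IsNondegenerateHom ρ₂ ρ₂') :
    IsNondegenerateHom (LinearMap.lTensorHom D₁ ∘ₗ ρ₂) (LinearMap.lTensorHom D₁ ∘ₗ ρ₂') where
  map_mul c c' d := by induction d <;> simp_all [h₂.map_mul]
  adjoint c d d' := by
    induction d with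
    | zero => simp
    | add u v hu hv => simp only [map_add, add_mul, hu, hv]
    | tmul x y => induction d' <;> simp_all [mul_add, h₂.adjoint]
  span_left := map₂_lTensorHom_eq_top h₂.span_left
  span_right := map₂_lTensorHom_eq_top h₂.span_right

variable [IsScalarTower ℂ C₁ C₁] [SMulCommClass ℂ C₁ C₁] [IsScalarTower ℂ C₂ C₂]
  [SMulCommClass ℂ C₂ C₂]

lemma tensorRep_mul {ρ₁ : C₁ →ₗ[ℂ] Module.End ℂ X₁} {ρ₂ : C₂ →ₗ[ℂ] Module.End ℂ X₂}
    (h₁ : ∀ c c' x, ρ₁ (c * c') x = ρ₁ c (ρ₁ c' x))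
    (h₂ : ∀ c c' x, ρ₂ (c * c') x = ρ₂ c (ρ₂ c' x)) (c c' : C₁ ⊗[ℂ] C₂) (x : X₁ ⊗[ℂ] X₂) :
    tensorRep ρ₁ ρ₂ (c * c') x = tensorRep ρ₁ ρ₂ c (tensorRep ρ₁ ρ₂ c' x) := by
  induction c with
  | zero => simp
  | add u v hu hv => simp only [map_add, LinearMap.add_apply, add_mul, hu, hv]
  | tmul a b =>
    induction c' with
    | zero => simp
    | add u v hu hv => simp only [map_add, LinearMap.add_apply, mul_add, hu, hv]
    | tmul a' b' => induction x <;> simp_all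

lemma IsNondegenerateHom.tensor (h₁ : IsNondegenerateHom ρ₁ ρ₁')
    (h₂ : IsNondegenerateHom ρ₂ ρ₂') :
    IsNondegenerateHom (tensorRep ρ₁ ρ₂) (tensorRep ρ₁' ρ₂') where
  map_mul := tensorRep_mul h₁.map_mul h₂.map_mul
  adjoint c d d' := by
    induction c with
    | zero => simp
    | add u v hu hv => simp only [map_add, LinearMap.add_apply, add_mul, mul_add, hu, hv]
    | tmul a b =>
      induction d with
      | zero => simp
      | add u v hu hv => simp only [map_add, add_mul, hu, hv]
      | tmul x y => induction d' <;> simp_all [mul_add, h₁.adjoint, h₂.adjoint]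
  span_left := map₂_tensorRep_eq_top h₁.span_left h₂.span_left
  span_right := map₂_tensorRep_eq_top h₁.span_right h₂.span_right

end TensorHom

namespace AlgebraicQuantumGroup

variable {A : Type*} [NonUnitalRing A] [Module ℂ A] [IsScalarTower ℂ A A] [SMulCommClass ℂ A A]
variable (G : AlgebraicQuantumGroup A)

open Multiplier

/-! ### The Heisenberg algebra -/

/-- The action `(a ⊗ b) ▷ x = a (b ▷ x)` of the Heisenberg algebra on `A`. -/
def heisRep : G.Heisenberg →ₗ[ℂ] Module.End ℂ A := G.heisAct

lemma heisRep_tmul (a : A) (b : G.Dual) (x : A) :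
    G.heisRep (a ⊗ₜ[ℂ] b : A ⊗[ℂ] G.Dual) x = a * G.act b x := rfl

lemma heisRep_injective : Function.Injective G.heisRep := G.heisAct_injective

lemma heisRep_mul (h k : G.Heisenberg) (x : A) :
    G.heisRep (h * k) x = G.heisRep h (G.heisRep k x) := G.heisAct_heisMul h k x

lemma heisenberg_induction {p : G.Heisenberg → Prop} (zero : p 0)
    (tmul : ∀ (a : A) (b : G.Dual), p (a ⊗ₜ[ℂ] b : A ⊗[ℂ] G.Dual))
    (add : ∀ h k, p h → p k → p (h + k)) (h : G.Heisenberg) : p h :=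
  TensorProduct.induction_on (motive := p) h zero tmul add

lemma heisRep_ext {h k : G.Heisenberg} (hk : ∀ x, G.heisRep h x = G.heisRep k x) : h = k :=
  G.heisRep_injective (LinearMap.ext hk)

lemma map₂_heisRep_eq_top : Submodule.map₂ G.heisRep ⊤ ⊤ = ⊤ :=
  map₂_eq_top_of_forall fun _ hS =>
    eq_top_of_map₂_eq_top G.map₂_mul_eq_top fun a x =>
      apply_mem_of_map₂_eq_top G.map₂_act_eq_top (LinearMap.mul ℂ A a)
        (fun b x => hS (a ⊗ₜ[ℂ] b : A ⊗[ℂ] G.Dual) x) x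

lemma eq_zero_of_heisRep {x : A} (hx : ∀ h, G.heisRep h x = 0) : x = 0 :=
  G.eq_zero_of_act fun b => G.nondegenerate.2 _ fun a => hx (a ⊗ₜ[ℂ] b : A ⊗[ℂ] G.Dual)

lemma heisenberg_nondegenerate : IsNondegenerateProduct G.Heisenberg := by
  refine ⟨fun h hh => G.heisRep_injective ?_, fun h hh => G.heisRep_ext fun x => ?_⟩
  · refine ext_of_map₂_eq_top G.map₂_heisRep_eq_top fun k x => ?_
    simp [← heisRep_mul, hh]
  · refine (G.eq_zero_of_heisRep fun k => ?_).trans (by simp)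
    simp [← heisRep_mul, hh]

lemma heisRep_jA (a : A) (h : G.Heisenberg) (x : A) :
    G.heisRep (G.jA a h) x = a * G.heisRep h x := G.heisAct_heisLeftA a h x

lemma heisRep_jB (b : G.Dual) (h : G.Heisenberg) (x : A) :
    G.heisRep (G.jB b h) x = G.act b (G.heisRep h x) := by
  induction h using heisenberg_induction with
  | zero => simp
  | add h k hh hk => simp only [map_add, LinearMap.add_apply, hh, hk]
  | tmul a' b' => exact G.act_mul_act b b' a' x

/-- The map `(u ⊗ v) ⊗ b ↦ u ⊗ (b ◁ v)`. -/
def actDualRight : (A ⊗[ℂ] A) ⊗[ℂ] G.Dual →ₗ[ℂ] A ⊗[ℂ] G.Dual :=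
  (TensorProduct.lift G.actDualR).lTensor A ∘ₗ (TensorProduct.assoc ℂ A A G.Dual).toLinearMap

/-- Right multiplication by `j_A(a)` on the Heisenberg algebra: `(a' ⊗ b') j_A(a)` is the sum of
the `u ⊗ (b' ◁ v)`, where `∑ u ⊗ v = (a' ⊗ 1)Δ(a)`. -/
def jAR : A →ₗ[ℂ] Module.End ℂ G.Heisenberg where
  toFun a := (G.actDualRight ∘ₗ
    (G.T₂.toLinearMap ∘ₗ (TensorProduct.mk ℂ A A).flip a).rTensor G.Dual :
      A ⊗[ℂ] G.Dual →ₗ[ℂ] A ⊗[ℂ] G.Dual)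
  map_add' a a' := by simp only [map_add, LinearMap.comp_add, LinearMap.rTensor_add]; rfl
  map_smul' r a := by simp only [map_smul, LinearMap.comp_smul, LinearMap.rTensor_smul]; rfl

lemma heisAct_actDualRight (t : A ⊗[ℂ] A) (b : G.Dual) (x : A) :
    G.heisAct (G.actDualRight (t ⊗ₜ b)) x = sliceR (G.eval b) ((G.Δ x).rmul t) := by
  induction t with
  | zero => simp
  | add s t hs ht => simp only [TensorProduct.add_tmul, map_add, LinearMap.add_apply, hs, ht]
  | tmul u v =>
    have hΔ : (G.Δ x).rmul (u ⊗ₜ v) = mulL₂ v (G.T₂ (u ⊗ₜ x)) := by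
      apply of_injective G.nondegenerate₂
      rw [← of_mul G.nondegenerate₂, G.of_mulL₂, ← T₂_spec, ← mul_assoc, of_tmul, tmul_mul_tmul,
        mul_one, one_mul]
    rw [hΔ, sliceR_lTensor]
    exact G.mul_act (G.actDualR v b) x u

lemma heisRep_jAR (a : A) (h : G.Heisenberg) (x : A) :
    G.heisRep (G.jAR a h) x = G.heisRep h (a * x) := by
  induction h using heisenberg_induction with
  | zero => simp
  | add h k hh hk => simp only [map_add, LinearMap.add_apply, hh, hk]
  | tmul a' b =>
    have hT : G.T₂ (a' ⊗ₜ (a * x)) = (G.Δ x).rmul (G.T₂ (a' ⊗ₜ a)) := G.T₂_mulR₂ x (a' ⊗ₜ a)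
    rw [heisRep_tmul, mul_act, hT]
    exact G.heisAct_actDualRight _ b x

/-- Right multiplication by `j_B(b)` on the Heisenberg algebra: `(a' ⊗ b') j_B(b) = a' ⊗ b'b`. -/
def jBR : G.Dual →ₗ[ℂ] Module.End ℂ G.Heisenberg :=
  (LinearMap.lTensorHom A ∘ₗ (LinearMap.mul ℂ G.Dual).flip :
    G.Dual →ₗ[ℂ] Module.End ℂ (A ⊗[ℂ] G.Dual))

lemma heisRep_jBR (b : G.Dual) (h : G.Heisenberg) (x : A) :
    G.heisRep (G.jBR b h) x = G.heisRep h (G.act b x) := by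
  induction h using heisenberg_induction with
  | zero => simp
  | add h k hh hk => simp only [map_add, LinearMap.add_apply, hh, hk]
  | tmul a' b' => exact congrArg (a' * ·) (G.act_mul b' b x)

lemma map₂_jAR_eq_top : Submodule.map₂ G.jAR ⊤ ⊤ = ⊤ := by
  refine map₂_eq_top_of_forall fun S hS => ?_
  have hT (b : G.Dual) (t : A ⊗[ℂ] A) : G.actDualRight (t ⊗ₜ b) ∈ S :=
    apply_mem_of_map₂_eq_top (map₂_compr₂_mk_eq_top (k := G.T₂.toLinearMap) G.T₂.surjective)
      (G.actDualRight ∘ₗ (TensorProduct.mk ℂ (A ⊗[ℂ] A) G.Dual).flip b)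
      (fun a' a => hS a (a' ⊗ₜ[ℂ] b : A ⊗[ℂ] G.Dual)) t
  exact eq_top_of_map₂_eq_top (TensorProduct.map₂_mk_top_top_eq_top ..) fun a b =>
    apply_mem_of_map₂_eq_top G.map₂_actDualR_eq_top (TensorProduct.mk ℂ A G.Dual a)
      (fun v b => hT b (a ⊗ₜ v)) b

lemma isNondegenerateHom_jA : IsNondegenerateHom G.jA G.jAR where
  map_mul a a' h := G.heisRep_ext fun x => by simp only [heisRep_jA, mul_assoc]
  adjoint a h k := G.heisRep_ext fun x => by simp only [heisRep_mul, heisRep_jA, heisRep_jAR]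
  span_left := map₂_rTensorHom_eq_top (X₂ := G.Dual) G.map₂_mul_eq_top
  span_right := G.map₂_jAR_eq_top

lemma dualT₁_surjective : Function.Surjective G.dualT₁ := by
  intro s
  obtain ⟨t, rfl⟩ := G.map_toDual_surjective s
  obtain ⟨t, rfl⟩ := (TensorProduct.comm ℂ A A).surjective t
  exact ⟨_, G.dualT₁_T₃ t⟩

lemma map₂_jB_eq_top : Submodule.map₂ G.jB ⊤ ⊤ = ⊤ := by
  refine map₂_eq_top_of_forall fun S hS => ?_
  have hT (a : A) (t : G.Dual ⊗[ℂ] G.Dual) : (G.act.flip a).rTensor G.Dual t ∈ S :=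
    apply_mem_of_map₂_eq_top (map₂_compr₂_mk_eq_top G.dualT₁_surjective)
      ((G.act.flip a).rTensor G.Dual) (fun b b' => hS b (a ⊗ₜ[ℂ] b' : A ⊗[ℂ] G.Dual)) t
  exact eq_top_of_map₂_eq_top (TensorProduct.map₂_mk_top_top_eq_top ..) fun a b =>
    apply_mem_of_map₂_eq_top G.map₂_act_eq_top ((TensorProduct.mk ℂ A G.Dual).flip b)
      (fun b' a => hT a (b' ⊗ₜ b)) a

lemma isNondegenerateHom_dual_mul :
    IsNondegenerateHom (LinearMap.mul ℂ G.Dual) (LinearMap.mul ℂ G.Dual).flip :=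
  isNondegenerateHom_mul G.map₂_dual_mul_eq_top

lemma isNondegenerateHom_jB : IsNondegenerateHom G.jB G.jBR where
  map_mul b b' h := G.heisRep_ext fun x => by simp only [heisRep_jB, act_mul]
  adjoint b h k := G.heisRep_ext fun x => by simp only [heisRep_mul, heisRep_jB, heisRep_jBR]
  span_left := G.map₂_jB_eq_top
  span_right := map₂_lTensorHom_eq_top (X₁ := A) G.isNondegenerateHom_dual_mul.span_right

lemma exists_isNondegenerateHom_leg₁₂ : ∃ ρ',
    IsNondegenerateHom (D := G.Dual ⊗[ℂ] (G.Heisenberg ⊗[ℂ] A)) G.leg₁₂ ρ' :=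
  ⟨_, G.isNondegenerateHom_dual_mul.tensor G.isNondegenerateHom_jA.rTensor⟩

lemma exists_isNondegenerateHom_leg₁₃ : ∃ ρ',
    IsNondegenerateHom (D := G.Dual ⊗[ℂ] (G.Heisenberg ⊗[ℂ] A)) G.leg₁₃ ρ' :=
  ⟨_, G.isNondegenerateHom_dual_mul.tensor (isNondegenerateHom_mul G.map₂_mul_eq_top).lTensor⟩

lemma exists_isNondegenerateHom_leg₂₃ : ∃ ρ',
    IsNondegenerateHom (D := G.Dual ⊗[ℂ] (G.Heisenberg ⊗[ℂ] A)) G.leg₂₃ ρ' :=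
  ⟨_, (G.isNondegenerateHom_jB.tensor (isNondegenerateHom_mul G.map₂_mul_eq_top)).lTensor⟩

lemma nondegenerate_legs :
    IsNondegenerateProduct (G.Dual ⊗[ℂ] (G.Heisenberg ⊗[ℂ] A)) :=
  G.dual_nondegenerate.tensor (G.heisenberg_nondegenerate.tensor G.nondegenerate)

/-! ### The action on `A ⊗ A` -/

lemma actTensor_tmul (t : G.Dual ⊗[ℂ] A) (x x' : A) :
    G.actTensor t (x ⊗ₜ x') = mulR₂ x' (G.actL x t) := by
  induction t with
  | zero => simp
  | add u v hu hv => simp only [map_add, LinearMap.add_apply, hu, hv]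
  | tmul b a => rfl

lemma actTensor_duality_lmul (t : G.Dual ⊗[ℂ] A) :
    G.actTensor (G.duality.lmul t) = (G.T₁.toLinearMap : Module.End ℂ (A ⊗[ℂ] A)) *
      G.actTensor t :=
  TensorProduct.ext' fun x x' => by
    rw [Module.End.mul_apply, actTensor_tmul, actTensor_tmul, LinearEquiv.coe_coe, T₁_mulR₂,
      actL_duality_lmul]

lemma map₂_actTensor_eq_top : Submodule.map₂ G.actTensor ⊤ ⊤ = ⊤ :=
  map₂_tensorRep_eq_top G.map₂_act_eq_top G.map₂_mul_eq_top

lemma existsUnique_extendsAction_actTensor :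
    ∃! σ : Multiplier (G.Dual ⊗[ℂ] A) →ₐ[ℂ] Module.End ℂ (A ⊗[ℂ] A),
      ExtendsAction G.actTensor σ :=
  existsUnique_extendsAction G.nondegenerate_dual_tensor
    (tensorRep_mul G.act_mul mul_assoc) G.map₂_actTensor_eq_top
    fun _ => eq_zero_of_tensorRep (fun _ => G.eq_zero_of_act) G.nondegenerate.2

lemma extension_duality {σ : Multiplier (G.Dual ⊗[ℂ] A) →ₐ[ℂ] Module.End ℂ (A ⊗[ℂ] A)}
    (hσ : ExtendsAction G.actTensor σ) : σ G.duality = G.T₁.toLinearMap :=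
  ext_of_map₂_eq_top G.map₂_actTensor_eq_top fun c x => by
    rw [hσ.apply G.nondegenerate_dual_tensor, actTensor_duality_lmul, Module.End.mul_apply]

end AlgebraicQuantumGroup

/-! ### The pentagon equation -/

section Legs

variable (R X : Type*) [CommRing R] [AddCommGroup X] [Module R X]

/-- Operators on `X ⊗ X`, acting on the first two legs of `X ⊗ X ⊗ X`. -/
def onLegs₁₂ : Module.End R (X ⊗[R] X) →ₐ[R] Module.End R (X ⊗[R] (X ⊗[R] X)) :=
  ((TensorProduct.assoc R X X X).conjAlgEquiv R).toAlgHom.comp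
    (Module.End.rTensorAlgHom R (X ⊗[R] X) X)

/-- Operators on `X ⊗ X`, acting on the first and the last leg of `X ⊗ X ⊗ X`. -/
def onLegs₁₃ : Module.End R (X ⊗[R] X) →ₐ[R] Module.End R (X ⊗[R] (X ⊗[R] X)) :=
  ((TensorProduct.leftComm R X X X).conjAlgEquiv R).toAlgHom.comp
    (Module.End.lTensorAlgHom R (X ⊗[R] X) X)

/-- Operators on `X ⊗ X`, acting on the last two legs of `X ⊗ X ⊗ X`. -/
def onLegs₂₃ : Module.End R (X ⊗[R] X) →ₐ[R] Module.End R (X ⊗[R] (X ⊗[R] X)) :=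
  Module.End.lTensorAlgHom R (X ⊗[R] X) X

variable {R X}

lemma onLegs₁₂_tmul (f : Module.End R (X ⊗[R] X)) (x y z : X) :
    onLegs₁₂ R X f (x ⊗ₜ (y ⊗ₜ z)) = TensorProduct.assoc R X X X (f (x ⊗ₜ y) ⊗ₜ z) := rfl

lemma onLegs₁₃_tmul (f : Module.End R (X ⊗[R] X)) (x y z : X) :
    onLegs₁₃ R X f (x ⊗ₜ (y ⊗ₜ z)) = TensorProduct.leftComm R X X X (y ⊗ₜ f (x ⊗ₜ z)) := rfl

lemma onLegs₂₃_tmul (f : Module.End R (X ⊗[R] X)) (x : X) (t : X ⊗[R] X) :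
    onLegs₂₃ R X f (x ⊗ₜ t) = x ⊗ₜ f t := rfl

end Legs

namespace AlgebraicQuantumGroup

variable {A : Type*} [NonUnitalRing A] [Module ℂ A] [IsScalarTower ℂ A A] [SMulCommClass ℂ A A]
variable (G : AlgebraicQuantumGroup A)

open Multiplier

/-- The canonical map `x ⊗ y ↦ Δ(x)(1 ⊗ y)` as an operator on `A ⊗ A`. -/
abbrev canonicalMap : Module.End ℂ (A ⊗[ℂ] A) := G.T₁.toLinearMap

/-- The map `t ↦ (x ↦ Δ(x)t)`. -/
def comulMul : A ⊗[ℂ] A →ₗ[ℂ] A →ₗ[ℂ] A ⊗[ℂ] A :=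
  LinearMap.mk₂ ℂ (fun t x => (G.Δ x).lmul t) (fun s t x => map_add (G.Δ x).lmul s t)
    (fun r t x => map_smul (G.Δ x).lmul r t) (fun t x y => by rw [map_add]; rfl)
    (fun r t x => by rw [map_smul]; rfl)

lemma mulR₁_lTensor_comulL_tmul (x y z w : A) :
    (mulR₁ y).lTensor A (G.comulL w (x ⊗ₜ z)) =
      (mulR₁ y ∘ₗ (TensorProduct.mk ℂ A A).flip z).lTensor A (G.T₂ (w ⊗ₜ x)) := by
  rw [comulL_tmul, ← lTensor_mk_flip, LinearMap.lTensor_comp_apply]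

lemma mulLeft_onLegs₁₂ (x y z w : A) :
    (LinearMap.mulLeft ℂ w).rTensor (A ⊗[ℂ] A)
        (onLegs₁₂ ℂ A G.canonicalMap (x ⊗ₜ (y ⊗ₜ z))) =
      (mulR₁ y).lTensor A (G.comulL w (x ⊗ₜ z)) := by
  have hassoc (t : A ⊗[ℂ] A) : (LinearMap.mulLeft ℂ w).rTensor (A ⊗[ℂ] A)
      (TensorProduct.assoc ℂ A A A (t ⊗ₜ z)) =
        TensorProduct.assoc ℂ A A A (mulL₁ w t ⊗ₜ z) := by
    induction t <;> simp_all [TensorProduct.add_tmul]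
  have hassoc' (t : A ⊗[ℂ] A) : (mulR₁ y).lTensor A (TensorProduct.assoc ℂ A A A (t ⊗ₜ z)) =
      TensorProduct.assoc ℂ A A A (mulR₂ y t ⊗ₜ z) := by
    induction t <;> simp_all [TensorProduct.add_tmul]
  rw [onLegs₁₂_tmul, hassoc, LinearEquiv.coe_coe, ← T₂_T₁, comulL_tmul, hassoc']

lemma mulLeft_onLegs₁₂_leftComm (y w : A) (t : A ⊗[ℂ] A) :
    (LinearMap.mulLeft ℂ w).rTensor (A ⊗[ℂ] A)
        (onLegs₁₂ ℂ A G.canonicalMap (TensorProduct.leftComm ℂ A A A (y ⊗ₜ t))) =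
      (mulR₁ y).lTensor A (G.comulL w t) := by
  induction t with
  | zero => simp
  | add s t hs ht => simp only [TensorProduct.tmul_add, map_add, hs, ht]
  | tmul x z => exact G.mulLeft_onLegs₁₂ x y z w

lemma mulLeft_onLegs₁₂_onLegs₁₃ (x w : A) (t : A ⊗[ℂ] A) :
    (LinearMap.mulLeft ℂ w).rTensor (A ⊗[ℂ] A)
        (onLegs₁₂ ℂ A G.canonicalMap (onLegs₁₃ ℂ A G.canonicalMap (x ⊗ₜ t))) =
      (G.comulMul t).lTensor A (G.T₂ (w ⊗ₜ x)) := by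
  induction t with
  | zero => simp
  | add s t hs ht =>
    simp only [TensorProduct.tmul_add, map_add, LinearMap.lTensor_add, LinearMap.add_apply, hs, ht]
  | tmul y z =>
    have hΔ : mulR₁ y ∘ₗ G.T₁.toLinearMap ∘ₗ (TensorProduct.mk ℂ A A).flip z =
        G.comulMul (y ⊗ₜ z) := LinearMap.ext fun s => G.T₁_mulRight s y z
    rw [onLegs₁₃_tmul, mulLeft_onLegs₁₂_leftComm, LinearEquiv.coe_coe, comulL_T₁, comulL_tmul,
      ← lTensor_mk_flip, ← hΔ, LinearMap.lTensor_comp_apply, LinearMap.lTensor_comp_apply]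

lemma mulLeft_onLegs₂₃_onLegs₁₂ (x y z w : A) :
    (LinearMap.mulLeft ℂ w).rTensor (A ⊗[ℂ] A)
        (onLegs₂₃ ℂ A G.canonicalMap (onLegs₁₂ ℂ A G.canonicalMap (x ⊗ₜ (y ⊗ₜ z)))) =
      (G.comulMul (G.T₁ (y ⊗ₜ z))).lTensor A (G.T₂ (w ⊗ₜ x)) := by
  have hΔ : G.T₁.toLinearMap ∘ₗ mulR₁ y ∘ₗ (TensorProduct.mk ℂ A A).flip z =
      G.comulMul (G.T₁ (y ⊗ₜ z)) := LinearMap.ext fun s => G.T₁_mul s y z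
  have hcomm (t : A ⊗[ℂ] (A ⊗[ℂ] A)) :
      (LinearMap.mulLeft ℂ w).rTensor (A ⊗[ℂ] A) (onLegs₂₃ ℂ A G.canonicalMap t) =
        G.T₁.toLinearMap.lTensor A ((LinearMap.mulLeft ℂ w).rTensor (A ⊗[ℂ] A) t) := by
    induction t <;> simp_all [onLegs₂₃_tmul]
  rw [hcomm, mulLeft_onLegs₁₂, mulR₁_lTensor_comulL_tmul, ← hΔ, ← LinearMap.lTensor_comp_apply]

lemma canonicalMap_pentagon :
    onLegs₁₂ ℂ A G.canonicalMap * onLegs₁₃ ℂ A G.canonicalMap * onLegs₂₃ ℂ A G.canonicalMap =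
      onLegs₂₃ ℂ A G.canonicalMap * onLegs₁₂ ℂ A G.canonicalMap :=
  TensorProduct.ext_threefold' fun x y z => sub_eq_zero.1 <|
    rTensor_jointly_injective (LinearMap.mulLeft ℂ) G.nondegenerate.2 _ fun w => by
      simp only [Module.End.mul_apply]
      rw [map_sub, sub_eq_zero, onLegs₂₃_tmul, mulLeft_onLegs₁₂_onLegs₁₃,
        mulLeft_onLegs₂₃_onLegs₁₂, LinearEquiv.coe_coe]

/-- The action of `B ⊗ AB ⊗ A` on `A ⊗ A ⊗ A`. -/
def legsRep : G.Dual ⊗[ℂ] (G.Heisenberg ⊗[ℂ] A) →ₗ[ℂ] Module.End ℂ (A ⊗[ℂ] (A ⊗[ℂ] A)) :=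
  tensorRep G.act (tensorRep G.heisRep (LinearMap.mul ℂ A))

lemma legsRep_injective : Function.Injective G.legsRep :=
  tensorRep_injective
    ((injective_iff_map_eq_zero _).2 fun _ hb => G.dual_eq_zero_of_act (LinearMap.congr_fun hb))
    (tensorRep_injective G.heisRep_injective
      ((injective_iff_map_eq_zero _).2 fun a ha => G.nondegenerate.1 a (LinearMap.congr_fun ha)))

section LegsIntertwining

variable {ρ : G.Dual ⊗[ℂ] A →ₗ[ℂ] Module.End ℂ (G.Dual ⊗[ℂ] (G.Heisenberg ⊗[ℂ] A))}
  {ι : Module.End ℂ (A ⊗[ℂ] A) →ₐ[ℂ] Module.End ℂ (A ⊗[ℂ] (A ⊗[ℂ] A))}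

lemma legsRep_apply_of_tmul
    (h : ∀ b a b' k a' x y z, G.legsRep (ρ (b ⊗ₜ a) (b' ⊗ₜ (k ⊗ₜ a'))) (x ⊗ₜ (y ⊗ₜ z)) =
      ι (G.actTensor (b ⊗ₜ a)) (G.legsRep (b' ⊗ₜ (k ⊗ₜ a')) (x ⊗ₜ (y ⊗ₜ z))))
    (c : G.Dual ⊗[ℂ] A) (d : G.Dual ⊗[ℂ] (G.Heisenberg ⊗[ℂ] A)) :
    G.legsRep (ρ c d) = ι (G.actTensor c) * G.legsRep d := by
  have : ρ.compr₂ G.legsRep =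
      (LinearMap.mul ℂ _).compl₁₂ (ι.toLinearMap ∘ₗ G.actTensor) G.legsRep :=
    TensorProduct.ext' fun b a => TensorProduct.ext_threefold' fun b' k a' =>
      TensorProduct.ext_threefold' fun x y z => h b a b' k a' x y z
  exact LinearMap.congr_fun₂ this c d

lemma legsRep_lmul_duality (hρ : Submodule.map₂ ρ ⊤ ⊤ = ⊤)
    (hι : ∀ c d, G.legsRep (ρ c d) = ι (G.actTensor c) * G.legsRep d)
    {θ : Multiplier (G.Dual ⊗[ℂ] A) →ₐ[ℂ] Multiplier (G.Dual ⊗[ℂ] (G.Heisenberg ⊗[ℂ] A))}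
    (hθ : ExtendsHom ρ θ) (d : G.Dual ⊗[ℂ] (G.Heisenberg ⊗[ℂ] A)) :
    G.legsRep ((θ G.duality).lmul d) = ι G.canonicalMap * G.legsRep d := by
  have : G.legsRep ∘ₗ (θ G.duality).lmul =
      LinearMap.mulLeft ℂ (ι G.canonicalMap) ∘ₗ G.legsRep :=
    ext_of_map₂_eq_top hρ fun c d => by
      simp only [LinearMap.comp_apply, LinearMap.mulLeft_apply]
      rw [hθ.lmul_apply G.nondegenerate_dual_tensor, hι, hι, actTensor_duality_lmul, map_mul,
        mul_assoc]
  exact LinearMap.congr_fun this d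

end LegsIntertwining

lemma legsRep_leg₁₂ (c : G.Dual ⊗[ℂ] A) (d : G.Dual ⊗[ℂ] (G.Heisenberg ⊗[ℂ] A)) :
    G.legsRep (G.leg₁₂ c d) = onLegs₁₂ ℂ A (G.actTensor c) * G.legsRep d := by
  refine G.legsRep_apply_of_tmul (ι := onLegs₁₂ ℂ A) (fun b a b' k a' x y z => ?_) c d
  change G.act (b * b') x ⊗ₜ (G.heisRep (G.jA a k) y ⊗ₜ (a' * z)) =
    G.act b (G.act b' x) ⊗ₜ ((a * G.heisRep k y) ⊗ₜ (a' * z))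
  rw [act_mul, heisRep_jA]

lemma legsRep_leg₁₃ (c : G.Dual ⊗[ℂ] A) (d : G.Dual ⊗[ℂ] (G.Heisenberg ⊗[ℂ] A)) :
    G.legsRep (G.leg₁₃ c d) = onLegs₁₃ ℂ A (G.actTensor c) * G.legsRep d := by
  refine G.legsRep_apply_of_tmul (ι := onLegs₁₃ ℂ A) (fun b a b' k a' x y z => ?_) c d
  change G.act (b * b') x ⊗ₜ (G.heisRep k y ⊗ₜ (a * a' * z)) =
    G.act b (G.act b' x) ⊗ₜ (G.heisRep k y ⊗ₜ (a * (a' * z)))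
  rw [act_mul, mul_assoc]

lemma legsRep_leg₂₃ (c : G.Dual ⊗[ℂ] A) (d : G.Dual ⊗[ℂ] (G.Heisenberg ⊗[ℂ] A)) :
    G.legsRep (G.leg₂₃ c d) = onLegs₂₃ ℂ A (G.actTensor c) * G.legsRep d := by
  refine G.legsRep_apply_of_tmul (ι := onLegs₂₃ ℂ A) (fun b a b' k a' x y z => ?_) c d
  change G.act b' x ⊗ₜ (G.heisRep (G.jB b k) y ⊗ₜ (a * a' * z)) =
    G.act b' x ⊗ₜ (G.act b (G.heisRep k y) ⊗ₜ (a * (a' * z)))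
  rw [heisRep_jB, mul_assoc]

lemma duality_pentagon
    {θ₁₂ θ₁₃ θ₂₃ : Multiplier (G.Dual ⊗[ℂ] A) →ₐ[ℂ]
      Multiplier (G.Dual ⊗[ℂ] (G.Heisenberg ⊗[ℂ] A))}
    (h₁₂ : ExtendsHom G.leg₁₂ θ₁₂) (h₁₃ : ExtendsHom G.leg₁₃ θ₁₃)
    (h₂₃ : ExtendsHom G.leg₂₃ θ₂₃) :
    θ₁₂ G.duality * θ₁₃ G.duality * θ₂₃ G.duality = θ₂₃ G.duality * θ₁₂ G.duality := by
  obtain ⟨_, hρ₁₂⟩ := G.exists_isNondegenerateHom_leg₁₂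
  obtain ⟨_, hρ₁₃⟩ := G.exists_isNondegenerateHom_leg₁₃
  obtain ⟨_, hρ₂₃⟩ := G.exists_isNondegenerateHom_leg₂₃
  have hV₁₂ := G.legsRep_lmul_duality hρ₁₂.span_left G.legsRep_leg₁₂ h₁₂
  have hV₁₃ := G.legsRep_lmul_duality hρ₁₃.span_left G.legsRep_leg₁₃ h₁₃
  have hV₂₃ := G.legsRep_lmul_duality hρ₂₃.span_left G.legsRep_leg₂₃ h₂₃
  refine Multiplier.ext_lmul G.nondegenerate_legs (LinearMap.ext fun d => G.legsRep_injective ?_)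
  simp only [lmul_mul, hV₁₂, hV₁₃, hV₂₃, ← mul_assoc, canonicalMap_pentagon]

end AlgebraicQuantumGroup

end

theorem proposition3p17 {A : Type*} [NonUnitalRing A] [Module ℂ A] [IsScalarTower ℂ A A]
    [SMulCommClass ℂ A A] (G : AlgebraicQuantumGroup A) :
    (∃! V : Multiplier (G.Dual ⊗[ℂ] A), G.IsDuality V) ∧
    (∃! σ : Multiplier (G.Dual ⊗[ℂ] A) →ₐ[ℂ] Module.End ℂ (A ⊗[ℂ] A),
      ExtendsAction G.actTensor σ) ∧
    (∃! θ : Multiplier (G.Dual ⊗[ℂ] A) →ₐ[ℂ]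
        Multiplier (G.Dual ⊗[ℂ] (G.Heisenberg ⊗[ℂ] A)), ExtendsHom G.leg₁₂ θ) ∧
    (∃! θ : Multiplier (G.Dual ⊗[ℂ] A) →ₐ[ℂ]
        Multiplier (G.Dual ⊗[ℂ] (G.Heisenberg ⊗[ℂ] A)), ExtendsHom G.leg₁₃ θ) ∧
    (∃! θ : Multiplier (G.Dual ⊗[ℂ] A) →ₐ[ℂ]
        Multiplier (G.Dual ⊗[ℂ] (G.Heisenberg ⊗[ℂ] A)), ExtendsHom G.leg₂₃ θ) ∧
    ∀ V : Multiplier (G.Dual ⊗[ℂ] A), G.IsDuality V →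
      (∀ σ : Multiplier (G.Dual ⊗[ℂ] A) →ₐ[ℂ] Module.End ℂ (A ⊗[ℂ] A),
        ExtendsAction G.actTensor σ →
          ∀ x x' : A, Multiplier.of (σ V (x ⊗ₜ x')) =
            G.Δ x * Multiplier.tmul 1 (Multiplier.of x')) ∧
      (∀ θ₁₂ θ₁₃ θ₂₃ : Multiplier (G.Dual ⊗[ℂ] A) →ₐ[ℂ]
          Multiplier (G.Dual ⊗[ℂ] (G.Heisenberg ⊗[ℂ] A)),
        ExtendsHom G.leg₁₂ θ₁₂ → ExtendsHom G.leg₁₃ θ₁₃ → ExtendsHom G.leg₂₃ θ₂₃ →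
          θ₁₂ V * θ₁₃ V * θ₂₃ V = θ₂₃ V * θ₁₂ V) := by
  obtain ⟨_, h₁₂⟩ := G.exists_isNondegenerateHom_leg₁₂
  obtain ⟨_, h₁₃⟩ := G.exists_isNondegenerateHom_leg₁₃
  obtain ⟨_, h₂₃⟩ := G.exists_isNondegenerateHom_leg₂₃
  refine ⟨G.existsUnique_isDuality, G.existsUnique_extendsAction_actTensor,
    h₁₂.existsUnique_extendsHom G.nondegenerate_dual_tensor G.nondegenerate_legs,
    h₁₃.existsUnique_extendsHom G.nondegenerate_dual_tensor G.nondegenerate_legs,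
    h₂₃.existsUnique_extendsHom G.nondegenerate_dual_tensor G.nondegenerate_legs, fun V hV => ?_⟩
  rw [hV.eq_duality]
  refine ⟨fun σ hσ x x' => ?_, fun θ₁₂ θ₁₃ θ₂₃ => G.duality_pentagon⟩
  rw [G.extension_duality hσ, G.T₁_spec]
  rfl
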